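/- Conventions. For points $p_1,\dots,p_4\in\mathbb R^3$ (indices modulo $4$) and $q\neq 0$, say that the line $(0,q)$ \emph{links} the skew quadrilateral with vertices $p_1,\dots,p_4$ (in this cyclic order) if the line through $0$ and $q$ does not meet the closed polygon $p_1p_2p_3p_4p_1$, the linking number of the line with the polygon (the number of times that the polygon winds around the line) is nonzero, and the linking takes place on the side of $q$, that is, the half-line from $0$ through $q$ meets the convex hull of $p_1,\dots,p_4$. Lemma. Fix real constants $\ell_i$, $k_i$, $h_i$ ($i=1,\dots,4$), $\epsilon$ and $\ell$ with $$\ell_i<\sqrt8,\quad k_i\in[2,2.61],\quad \epsilon\ge 2,\quad h_i\in[2,\sqrt8],\quad \ell\in[2,\sqrt8].$$ (1) Consider configurations of seven points $0,p_1,\dots,p_4,q_1,q_2$ in $\mathbb R^3$ such that $|p_i-q_j|\ge h_i$ for all $i,j$; $|q_1-q_2|\ge\epsilon$; all other pairs of distinct points among the seven have distance at least $2$ (so $|p_i|\ge2$, $|q_j|\ge2$, and $|p_i-p_{i'}|\ge2$ for $i\ne i'$); $|p_i|\le\ell_i$; $|q_j|\le\ell$; $|p_i-p_{i+1}|\le k_i$;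 and for $j=1,2$ the line $(0,q_j)$ links the skew quadrilateral with vertices $p_1,\dots,p_4$. If such a configuration exists, then there also exists such a configuration with the additional properties $$|p_i|=2,\quad |p_i-p_{i+1}|=k_i,\quad |q_j|=\ell\qquad(i=1,\dots,4,\ j=1,2).$$ (2) Consider configurations of six points $0,p_1,\dots,p_4,q$ in $\mathbb R^3$ such that $|p_i-q|\ge h_i$ for all $i$; all other pairs of distinct points among the six have distance at least $2$; $|p_i|\le\ell_i$; $|q|\le\ell$; $|p_i-p_{i+1}|\le k_i$; and the line $(0,q)$ links the skew quadrilateral with vertices $p_1,\dots,p_4$. If such a configuration exists, then there also exists such a configuration with $|p_i|=2$, $|p_i-p_{i+1}|=k_i$ and $|q|=\ell$ for all $i$. -/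

import Mathlib

/-- Euclidean three-space. -/
abbrev R3 : Type := EuclideanSpace ℝ (Fin 3)

/-- The signed dihedral angle, in `(-π, π]`, at the oriented line through `0` and `u`, from the
half-plane through `a` to the half-plane through `b`.  If `a'` and `b'` are the orthogonal
projections of `a` and `b` to the plane `u^⊥`, the complex number below has real part
`‖u‖² ⟪a', b'⟫` and imaginary part `‖u‖² ` times the signed area of the parallelogram spanned by
`a'` and `b'`, so that its argument is the oriented angle from `a'` to `b'`. -/
noncomputable def signedDihedralAngle (u a b : R3) : ℝ :=
  Complex.arg
    ⟨‖u‖ ^ 2 * inner ℝ a b - inner ℝ u a * inner ℝ u b,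
      ‖u‖ * dotProduct u.ofLp (crossProduct a.ofLp b.ofLp)⟩

/-- The linking number of the oriented line through `0` and `u` with the closed polygon
`p 0, p 1, …, p (n-1), p 0` (indices are cyclic): the number of times that the polygon winds
around the line.  It is meaningful when `u ≠ 0` and the polygon does not meet the line. -/
noncomputable def linkingNumber {n : ℕ} [NeZero n] (u : R3) (p : Fin n → R3) : ℝ :=
  (∑ i, signedDihedralAngle u (p i) (p (i + 1))) / (2 * Real.pi)

/-- The line through `0` and `u` links the closed polygon with consecutive vertices `p i`: it does
not meet the polygon, and the linking number is nonzero. -/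
def LineLinks {n : ℕ} [NeZero n] (u : R3) (p : Fin n → R3) : Prop :=
  u ≠ 0 ∧
  (∀ i, ∀ x ∈ segment ℝ (p i) (p (i + 1)), x ∉ Submodule.span ℝ {u}) ∧
  linkingNumber u p ≠ 0

/-- The line through `0` and `u` links the closed polygon with consecutive vertices `p i`, and it
does so on the side of `u`: the half-line from `0` through `u` meets the convex hull
of the polygon. -/
def HalfLineLinks {n : ℕ} [NeZero n] (u : R3) (p : Fin n → R3) : Prop :=
  LineLinks u p ∧ ∃ t : ℝ, 0 < t ∧ t • u ∈ convexHull ℝ (Set.range p)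

/-- A configuration of six points `0, p 0, …, p 3, q` with lower distance bounds
`h i` for `(p i, q)` and `2` for all other pairs, upper distance bounds `l i` for `(0, p i)`,
`L` for `(0, q)` and `k i` for `(p i, p (i + 1))` (indices modulo `4`),
in which the line `(0, q)` links the skew quadrilateral with vertices `p i`. -/
structure IsSixPointConfig (l k h : Fin 4 → ℝ) (L : ℝ) (p : Fin 4 → R3) (q : R3) : Prop where
  two_le_norm_p : ∀ i, 2 ≤ ‖p i‖
  two_le_norm_q : 2 ≤ ‖q‖
  two_le_dist_p : ∀ i j, i ≠ j → 2 ≤ dist (p i) (p j)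
  le_dist_p_q : ∀ i, h i ≤ dist (p i) q
  norm_p_le : ∀ i, ‖p i‖ ≤ l i
  norm_q_le : ‖q‖ ≤ L
  dist_p_le : ∀ i, dist (p i) (p (i + 1)) ≤ k i
  links : HalfLineLinks q p

/-- A configuration of seven points `0, p 0, …, p 3, q 0, q 1` with lower distance bounds
`h i` for `(p i, q j)`, `ε` for `(q 0, q 1)` and `2` for all other pairs, upper distance bounds
`l i` for `(0, p i)`, `L` for `(0, q j)` and `k i` for `(p i, p (i + 1))` (indices modulo `4`),
in which both lines `(0, q j)` link the skew quadrilateral with vertices `p i`. -/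
structure IsSevenPointConfig (l k h : Fin 4 → ℝ) (ε L : ℝ) (p : Fin 4 → R3) (q : Fin 2 → R3) :
    Prop where
  two_le_norm_p : ∀ i, 2 ≤ ‖p i‖
  two_le_norm_q : ∀ j, 2 ≤ ‖q j‖
  two_le_dist_p : ∀ i j, i ≠ j → 2 ≤ dist (p i) (p j)
  le_dist_p_q : ∀ i j, h i ≤ dist (p i) (q j)
  le_dist_q : ε ≤ dist (q 0) (q 1)
  norm_p_le : ∀ i, ‖p i‖ ≤ l i
  norm_q_le : ∀ j, ‖q j‖ ≤ L
  dist_p_le : ∀ i, dist (p i) (p (i + 1)) ≤ k i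
  links : ∀ j, HalfLineLinks (q j) p

open scoped ComplexConjugate Topology
open Real (pi)
open InnerProductGeometry (angle angle_nonneg angle_le_pi)

/-!
Within the given bounds the vertices of the quadrilateral keep a distance of at least `√2` from
each axis `(0, q j)`, so that linking means that the quadrilateral winds once around the axis,
all four of its edges turning in the same direction; a reflection in the origin makes all these
directions positive. Pushing the `q j` outwards to norm `L` does not decrease any distance, and
for fixed `q j` the admissible quadrilaterals form a compact set.

On this set take one that minimises `∑ i, ‖p i‖`. If its longest vertex had norm greater than `2`,
then this vertex, after a reflection in the plane of the origin and its two neighbours if necessary,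
could be rotated towards the origin about the line through its neighbours: it moves away from the
`q j`, which lie on the other side of the plane of the three vertices. Hence all norms are `2`.
Among the admissible quadrilaterals with this property take one that maximises the sum of the edge
lengths. If an edge were too short, one of its ends could be rotated away from the other end about
the line through the origin and its other neighbour, which again moves it away from the `q j`.
-/

section Norm

variable {E : Type*} [NormedAddCommGroup E]

theorem four_le_sq {r : ℝ} (h : 2 ≤ r) : 4 ≤ r ^ 2 := by nlinarith

theorem norm_sq_lt_eight {a : E} (h : ‖a‖ < √8) : ‖a‖ ^ 2 < 8 :=
  (Real.lt_sqrt (norm_nonneg a)).1 h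

theorem norm_sq_le_eight {a : E} (h : ‖a‖ ≤ √8) : ‖a‖ ^ 2 ≤ 8 :=
  (Real.le_sqrt (norm_nonneg a) (by norm_num)).1 h

/-- The metric constraints, up to symmetry, on the vertices of the skew quadrilateral. -/
structure IsFrame (p : Fin 4 → E) : Prop where
  two_le_norm : ∀ i, 2 ≤ ‖p i‖
  norm_lt : ∀ i, ‖p i‖ < √8
  two_le_dist : ∀ i j, i ≠ j → 2 ≤ dist (p i) (p j)
  dist_le : ∀ i, dist (p i) (p (i + 1)) ≤ 2.61

/-- The metric constraints on a point `q` through which a half-line is drawn, relative to the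
vertices `p i` of a skew quadrilateral. -/
structure IsAxis (p : Fin 4 → E) (q : E) : Prop where
  two_le_norm : 2 ≤ ‖q‖
  norm_le : ‖q‖ ≤ √8
  two_le_dist : ∀ i, 2 ≤ dist (p i) q

theorem IsFrame.neg {p : Fin 4 → E} (hp : IsFrame p) : IsFrame (-p) where
  two_le_norm i := by simpa using hp.two_le_norm i
  norm_lt i := by simpa using hp.norm_lt i
  two_le_dist i j hij := by simpa using hp.two_le_dist i j hij
  dist_le i := by simpa using hp.dist_le i

theorem IsAxis.ne_zero {p : Fin 4 → E} {q : E} (hq : IsAxis p q) : q ≠ 0 :=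
  norm_pos_iff.1 (two_pos.trans_le hq.two_le_norm)

theorem IsAxis.neg {p : Fin 4 → E} {q : E} (hq : IsAxis p q) : IsAxis (-p) (-q) where
  two_le_norm := by simpa using hq.two_le_norm
  norm_le := by simpa using hq.norm_le
  two_le_dist i := by simpa using hq.two_le_dist i

end Norm

section InnerProductSpace

variable {E : Type*} [NormedAddCommGroup E] [InnerProductSpace ℝ E]

theorem dist_sq_eq (a b : E) : dist a b ^ 2 = ‖a‖ ^ 2 - 2 * inner ℝ a b + ‖b‖ ^ 2 := by
  rw [dist_eq_norm, norm_sub_sq_real]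

theorem sq_le_of_le_dist {a b : E} {c : ℝ} (hc : 0 ≤ c) (h : c ≤ dist a b) :
    c ^ 2 ≤ ‖a‖ ^ 2 - 2 * inner ℝ a b + ‖b‖ ^ 2 :=
  dist_sq_eq a b ▸ pow_le_pow_left₀ hc h 2

theorem le_sq_of_dist_le {a b : E} {c : ℝ} (h : dist a b ≤ c) :
    ‖a‖ ^ 2 - 2 * inner ℝ a b + ‖b‖ ^ 2 ≤ c ^ 2 :=
  dist_sq_eq a b ▸ pow_le_pow_left₀ dist_nonneg h 2

theorem exists_forall_inner_pos {p : Fin 4 → E} (h : ∀ i, 0 < inner ℝ (p i) (p (i + 1))) :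
    ∃ u : E, ∀ i, 0 < inner ℝ u (p i) := by
  have h01 : 0 < inner ℝ (p 0) (p 1) := h 0
  have h21 : 0 < inner ℝ (p 2) (p 1) := real_inner_comm (p 1) (p 2) ▸ h 1
  have h23 : 0 < inner ℝ (p 2) (p 3) := h 2
  have h03 : 0 < inner ℝ (p 0) (p 3) := real_inner_comm (p 3) (p 0) ▸ h 3
  have pos_of_inner {x y : E} (hxy : 0 < inner ℝ x y) : 0 < ‖x‖ :=
    norm_pos_iff.2 fun hx => by simp [hx] at hxy
  have h0 := pos_of_inner h01
  have h2 := pos_of_inner h21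
  set u := ‖p 2‖ • p 0 + ‖p 0‖ • p 2 with hu
  have inner_u (x : E) : inner ℝ u x = ‖p 2‖ * inner ℝ (p 0) x + ‖p 0‖ * inner ℝ (p 2) x := by
    rw [hu, inner_add_left, real_inner_smul_left, real_inner_smul_left]
  have hu1 : 0 < inner ℝ u (p 1) := by rw [inner_u]; positivity
  have hu3 : 0 < inner ℝ u (p 3) := by rw [inner_u]; positivity
  -- `u` bisects the angle between `p 0` and `p 2`, and it is nonzero because `⟪u, p 1⟫ ≠ 0`.
  have hu_sq : 0 < inner ℝ u u := real_inner_self_pos.2 fun h => by simp [h] at hu1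
  have hu02 : ‖p 2‖ * inner ℝ u (p 0) = ‖p 0‖ * inner ℝ u (p 2) := by
    rw [inner_u, inner_u, real_inner_comm (p 2) (p 0), real_inner_self_eq_norm_sq,
      real_inner_self_eq_norm_sq]
    ring
  have huu : inner ℝ u u = ‖p 2‖ * inner ℝ u (p 0) + ‖p 0‖ * inner ℝ u (p 2) := by
    rw [inner_u, real_inner_comm u, real_inner_comm u]
  refine ⟨u, fun i => ?_⟩
  fin_cases i
  · exact pos_of_mul_pos_right (by linarith : 0 < ‖p 2‖ * inner ℝ u (p 0)) h2.le
  · exact hu1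
  · exact pos_of_mul_pos_right (by linarith : 0 < ‖p 0‖ * inner ℝ u (p 2)) h0.le
  · exact hu3

theorem IsFrame.inner_pos {p : Fin 4 → E} (hp : IsFrame p) (i : Fin 4) :
    0 < inner ℝ (p i) (p (i + 1)) := by
  linarith [four_le_sq (hp.two_le_norm i), four_le_sq (hp.two_le_norm (i + 1)),
    le_sq_of_dist_le (hp.dist_le i)]

theorem IsFrame.exists_hemisphere {p : Fin 4 → E} (hp : IsFrame p) :
    ∃ u : E, ∀ i, 0 < inner ℝ u (p i) :=
  exists_forall_inner_pos hp.inner_pos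

/-- Every vector that is positive on all `p i` is nonnegative on `q`.  If some vector is positive
on all `p i`, this says that `q` lies in the closed convex cone spanned by the `p i`; in this form
the condition is visibly closed in `p`. -/
def InBidualCone {ι : Type*} (p : ι → E) (q : E) : Prop :=
  ∀ v : E, (∀ i, 0 < inner ℝ v (p i)) → 0 ≤ inner ℝ v q

theorem InBidualCone.neg {ι : Type*} {p : ι → E} {q : E} (h : InBidualCone p q) :
    InBidualCone (-p) (-q) := fun v hv => by
  simpa using h (-v) fun i => by simpa using hv i

theorem InBidualCone.of_smul_mem_convexHull {ι : Type*} {p : ι → E} {q : E} {t : ℝ} (ht : 0 < t)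
    (h : t • q ∈ convexHull ℝ (Set.range p)) : InBidualCone p q := fun v hv => by
  have hsub : convexHull ℝ (Set.range p) ⊆ {x | 0 ≤ inner ℝ v x} := by
    refine convexHull_min ?_ (convex_halfSpace_ge (innerₛₗ ℝ v).isLinear 0)
    rintro - ⟨i, rfl⟩
    exact (hv i).le
  have htq : 0 ≤ t * inner ℝ v q := real_inner_smul_right v q t ▸ hsub h
  exact nonneg_of_mul_nonneg_right htq ht

theorem one_lt_sum_of_eq_sum_smul {ι : Type*} [Fintype ι] {a : ι → E} {x : E} {α : ι → ℝ}
    (hα : ∀ i, 0 ≤ α i) (hx : x = ∑ i, α i • a i) (hx2 : 2 ≤ ‖x‖) (ha : ∀ i, ‖a i‖ < √8)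
    (hax : ∀ i, 2 ≤ dist (a i) x) : 1 < ∑ i, α i := by
  have hx4 := four_le_sq hx2
  have hinner : ∀ i, 2 * inner ℝ (a i) x < ‖x‖ ^ 2 + 4 := fun i => by
    linarith [sq_le_of_le_dist two_pos.le (hax i), norm_sq_lt_eight (ha i)]
  obtain ⟨i, hi⟩ : ∃ i, 0 < α i := by
    by_contra! hnonpos
    have hzero : ∀ i, α i = 0 := fun i => (hnonpos i).antisymm (hα i)
    simp only [hzero, zero_smul, Finset.sum_const_zero] at hx
    norm_num [hx] at hx2
  by_contra! hle
  have : 2 * ‖x‖ ^ 2 < ‖x‖ ^ 2 + 4 := calc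
    2 * ‖x‖ ^ 2 = ∑ i, α i * (2 * inner ℝ (a i) x) := by
      rw [← real_inner_self_eq_norm_sq]
      nth_rewrite 1 [hx]
      simp only [sum_inner, real_inner_smul_left, Finset.mul_sum, mul_left_comm]
    _ < ∑ i, α i * (‖x‖ ^ 2 + 4) :=
      Finset.sum_lt_sum (fun j _ => mul_le_mul_of_nonneg_left (hinner j).le (hα j))
        ⟨i, Finset.mem_univ i, mul_lt_mul_of_pos_left (hinner i) hi⟩
    _ = (∑ i, α i) * (‖x‖ ^ 2 + 4) := by rw [Finset.sum_mul]
    _ ≤ ‖x‖ ^ 2 + 4 := mul_le_of_le_one_left (by positivity) hle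
  linarith

theorem dist_le_dist_smul {a q : E} {t : ℝ} (ht : 1 ≤ t) (h : inner ℝ a q ≤ ‖q‖ ^ 2) :
    dist a q ≤ dist a (t • q) := by
  refine (sq_le_sq₀ dist_nonneg dist_nonneg).1 ?_
  rw [dist_sq_eq, dist_sq_eq, norm_smul, Real.norm_eq_abs, mul_pow, sq_abs, real_inner_smul_right]
  nlinarith [mul_nonneg (sub_nonneg.2 ht) (sub_nonneg.2 h),
    mul_nonneg (sq_nonneg (t - 1)) (sq_nonneg ‖q‖)]

theorem inner_le_norm_sq {a q : E} (ha : ‖a‖ ≤ √8) (hq : 2 ≤ ‖q‖) (h : 2 ≤ dist a q) :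
    inner ℝ a q ≤ ‖q‖ ^ 2 := by
  linarith [norm_sq_le_eight ha, four_le_sq hq, sq_le_of_le_dist two_pos.le h]

section Angle

variable {x y z q : E}

theorem angle_add_angle_le_of_eq_add {α β γ : ℝ} (hα : 0 ≤ α) (hβ : 0 ≤ β) (hγ : 0 ≤ γ)
    (hq : q = α • x + (β • y + γ • z)) (hq0 : q ≠ 0) (hw0 : β • y + γ • z ≠ 0) :
    angle x q + angle q z ≤ angle x y + angle y z := by
  open InnerProductGeometry in
  lift α to NNReal using hα
  lift β to NNReal using hβ
  lift γ to NNReal using hγ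
  set w := (β : ℝ) • y + (γ : ℝ) • z with hw
  have hxw : angle x w = angle x q + angle q w := by
    apply angle_eq_angle_add_add_angle_add_of_mem_span hq0
    rw [Submodule.mem_span_pair]
    exact ⟨α, 1, by simp only [hq, hw, NNReal.smul_def, one_smul]⟩
  have hyz : angle y z = angle y w + angle w z := by
    apply angle_eq_angle_add_add_angle_add_of_mem_span hw0
    rw [Submodule.mem_span_pair]
    exact ⟨β, γ, by simp only [hw, NNReal.smul_def]⟩
  linarith [angle_le_angle_add_angle q w z, angle_le_angle_add_angle x y w]

theorem angle_le_of_dist_le (hx : 2 ≤ ‖x‖) (hy : 2 ≤ ‖y‖) (h : dist x y ≤ 2.61) :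
    angle x y ≤ pi / 2 - 0.148 := by
  have hxy : 0 < ‖x‖ * ‖y‖ := by positivity
  have hcos : 0.148 ≤ Real.cos (angle x y) := by
    rw [InnerProductGeometry.cos_angle, le_div_iff₀ hxy]
    nlinarith [le_sq_of_dist_le h, mul_nonneg (sub_nonneg.2 hx) (sub_nonneg.2 hy),
      sq_nonneg (‖x‖ - ‖y‖)]
  have hsin : Real.cos (pi / 2 - 0.148) ≤ Real.cos (angle x y) := by
    rw [Real.cos_pi_div_two_sub]
    exact (Real.sin_le (by norm_num)).trans hcos
  refine (Real.strictAntiOn_cos.le_iff_ge ⟨?_, ?_⟩ ⟨angle_nonneg x y, angle_le_pi x y⟩).1 hsin <;>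
    linarith [Real.pi_gt_three]

theorem pi_div_six_le_angle (hx : 2 ≤ ‖x‖) (hy : 2 ≤ ‖y‖) (hx' : ‖x‖ ≤ √8) (hy' : ‖y‖ ≤ √8)
    (h : 2 ≤ dist x y) : pi / 6 ≤ angle x y := by
  have hxy : 0 < ‖x‖ * ‖y‖ := by positivity
  have h8 : √8 ≤ 2.83 := (Real.sqrt_le_left (by norm_num)).2 (by norm_num)
  have h3 : 1.72 ≤ √3 := Real.le_sqrt_of_sq_le (by norm_num)
  have hinner : inner ℝ x y ≤ 0.86 * (‖x‖ * ‖y‖) := by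
    nlinarith [sq_le_of_le_dist two_pos.le h,
      mul_nonneg (sub_nonneg.2 hx) (sub_nonneg.2 (hy'.trans h8)),
      mul_nonneg (sub_nonneg.2 hy) (sub_nonneg.2 (hx'.trans h8)),
      mul_nonneg (sub_nonneg.2 hx) (sub_nonneg.2 (hx'.trans h8)),
      mul_nonneg (sub_nonneg.2 hy) (sub_nonneg.2 (hy'.trans h8)),
      mul_nonneg (sub_nonneg.2 hx) (sub_nonneg.2 hy)]
  have hcos : Real.cos (angle x y) ≤ Real.cos (pi / 6) := by
    rw [Real.cos_pi_div_six, InnerProductGeometry.cos_angle, div_le_iff₀ hxy]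
    nlinarith
  refine (Real.strictAntiOn_cos.le_iff_ge ⟨angle_nonneg x y, angle_le_pi x y⟩ ⟨?_, ?_⟩).1 hcos <;>
    linarith [Real.pi_pos]

theorem inner_gt_of_eq_add {α β γ : ℝ} (hα : 0 ≤ α) (hβ : 0 ≤ β) (hγ : 0 ≤ γ)
    (hq : q = α • x + (β • y + γ • z)) (hx : 2 ≤ ‖x‖) (hy : 2 ≤ ‖y‖) (hz : 2 ≤ ‖z‖)
    (hz' : ‖z‖ ≤ √8) (hq2 : 2 ≤ ‖q‖) (hq' : ‖q‖ ≤ √8) (hxy : dist x y ≤ 2.61)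
    (hyz : dist y z ≤ 2.61) (hzq : 2 ≤ dist z q) : -(√2 / 2 * (‖x‖ * ‖q‖)) < inner ℝ x q := by
  have hxq : 0 < ‖x‖ * ‖q‖ := by positivity
  by_cases hw0 : β • y + γ • z = 0
  · have hnonneg : 0 ≤ inner ℝ x q := by
      rw [hq, hw0, add_zero, real_inner_smul_right, real_inner_self_eq_norm_sq]
      positivity
    have : 0 < √2 / 2 * (‖x‖ * ‖q‖) := by positivity
    linarith
  have hq0 : q ≠ 0 := norm_pos_iff.1 (two_pos.trans_le hq2)
  have hangle : angle x q < pi - pi / 4 := by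
    linarith [angle_add_angle_le_of_eq_add hα hβ hγ hq hq0 hw0, angle_le_of_dist_le hx hy hxy,
      angle_le_of_dist_le hy hz hyz, Real.pi_lt_d2,
      pi_div_six_le_angle hq2 hz hq' hz' (by rwa [dist_comm])]
  have hcos := Real.cos_lt_cos_of_nonneg_of_le_pi (angle_nonneg x q) (by linarith [Real.pi_pos])
    hangle
  rw [Real.cos_pi_sub, Real.cos_pi_div_four, InnerProductGeometry.cos_angle, lt_div_iff₀ hxq]
    at hcos
  linarith

end Angle

end InnerProductSpace

section Fin4

theorem forall_fin_four {P : Fin 4 → Prop} (i : Fin 4) (h0 : P i) (h1 : P (i + 1))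
    (h2 : P (i + 2)) (h3 : P (i + 3)) : ∀ j, P j := by
  intro j
  fin_cases i <;> fin_cases j <;> assumption

theorem sum_fin_four {M : Type*} [AddCommMonoid M] (f : Fin 4 → M) (i : Fin 4) :
    ∑ j, f j = f i + f (i + 1) + f (i + 2) + f (i + 3) := by
  rw [← Equiv.sum_comp (Equiv.addLeft i), Fin.sum_univ_four]
  simp only [Equiv.coe_addLeft, add_zero]

end Fin4

section Turn

/-- The angle, in `(-π, π]`, by which a point turns about the origin of the plane when moving from
`a` to `b`. -/
noncomputable def turn (a b : ℂ) : ℝ :=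
  Complex.arg (conj a * b)

variable {a b c : ℂ}

theorem conj_mul_re_eq (a b : ℂ) : (conj a * b).re = ‖a‖ * ‖b‖ * Real.cos (turn a b) := by
  rw [turn, ← Complex.norm_conj a, ← norm_mul, Complex.norm_mul_cos_arg]

theorem conj_mul_im_eq (a b : ℂ) : (conj a * b).im = ‖a‖ * ‖b‖ * Real.sin (turn a b) := by
  rw [turn, ← Complex.norm_conj a, ← norm_mul, Complex.norm_mul_sin_arg]

theorem norm_sub_sq_eq_conj_mul_re (a b : ℂ) :
    ‖a - b‖ ^ 2 = ‖a‖ ^ 2 - 2 * (conj a * b).re + ‖b‖ ^ 2 := by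
  rw [norm_sub_sq_real, Complex.inner, mul_comm b]

theorem cos_turn_comm (a b : ℂ) : Real.cos (turn a b) = Real.cos (turn b a) := by
  have hconj : conj b * a = conj (conj a * b) := by
    rw [map_mul, Complex.conj_conj, mul_comm]
  rw [turn, turn, hconj, ← Real.Angle.cos_coe, ← Real.Angle.cos_coe, Complex.arg_conj_coe_angle,
    Real.Angle.cos_neg]

theorem turn_conj_conj (h : turn a b ≠ pi) : turn (conj a) (conj b) = -turn a b := by
  rw [turn, ← map_mul, Complex.arg_conj]
  exact if_neg h

theorem coe_turn (ha : a ≠ 0) (hb : b ≠ 0) :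
    (turn a b : Real.Angle) = (Complex.arg b : Real.Angle) - Complex.arg a := by
  rw [turn, Complex.arg_mul_coe_angle ((map_ne_zero _).2 ha) hb, Complex.arg_conj_coe_angle,
    neg_add_eq_sub]

theorem coe_turn_add_turn (ha : a ≠ 0) (hb : b ≠ 0) (hc : c ≠ 0) :
    ((turn a b + turn b c : ℝ) : Real.Angle) = turn a c := by
  rw [Real.Angle.coe_add, coe_turn ha hb, coe_turn hb hc, coe_turn ha hc, add_comm,
    sub_add_sub_cancel]

theorem cos_turn_add_turn (ha : a ≠ 0) (hb : b ≠ 0) (hc : c ≠ 0) :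
    Real.cos (turn a b + turn b c) = Real.cos (turn a c) := by
  rw [← Real.Angle.cos_coe, coe_turn_add_turn ha hb hc, Real.Angle.cos_coe]

theorem sin_turn_add_turn (ha : a ≠ 0) (hb : b ≠ 0) (hc : c ≠ 0) :
    Real.sin (turn a b + turn b c) = Real.sin (turn a c) := by
  rw [← Real.Angle.sin_coe, coe_turn_add_turn ha hb hc, Real.Angle.sin_coe]

theorem turn_pos_and_lt_pi_iff : 0 < turn a b ∧ turn a b < pi ↔ 0 < (conj a * b).im := by
  constructor
  · rintro ⟨hpos, hlt⟩
    have hne : conj a * b ≠ 0 := fun h => hpos.ne' (by rw [turn, h, Complex.arg_zero])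
    rw [conj_mul_im_eq, ← Complex.norm_conj a, ← norm_mul]
    exact mul_pos (norm_pos_iff.2 hne) (Real.sin_pos_of_pos_of_lt_pi hpos hlt)
  · intro h
    refine ⟨(Complex.arg_nonneg_iff.2 h.le).lt_of_ne' fun h0 => ?_,
      Complex.arg_lt_pi_iff.2 (Or.inr h.ne')⟩
    exact h.ne' (Complex.arg_eq_zero_iff.1 h0).2

theorem conj_mul_im_pos_of_turn_add (ha : a ≠ 0) (hb : b ≠ 0) (hc : c ≠ 0)
    (h : pi < turn a b + turn b c) (h' : turn a b + turn b c < 2 * pi) :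
    0 < (conj c * a).im := by
  have hsin : Real.sin (turn a c) < 0 := by
    rw [← sin_turn_add_turn ha hb hc, ← neg_pos, ← Real.sin_sub_pi]
    exact Real.sin_pos_of_pos_of_lt_pi (by linarith) (by linarith)
  have hconj : conj c * a = conj (conj a * c) := by
    rw [map_mul, Complex.conj_conj, mul_comm]
  rw [hconj, Complex.conj_im, conj_mul_im_eq, neg_pos]
  exact mul_neg_of_pos_of_neg (by positivity) hsin

theorem cos_turn_zero_eq_one {a : Fin 4 → ℂ} (ha : ∀ i, a i ≠ 0)
    (h : ∀ i, turn (a i) (a (i + 1)) = 0) (i : Fin 4) : Real.cos (turn (a 0) (a i)) = 1 := by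
  have h0 : turn (a 0) (a 1) = 0 := h 0
  have h1 : turn (a 1) (a 2) = 0 := h 1
  have h3 : turn (a 3) (a 0) = 0 := h 3
  fin_cases i
  · change Real.cos (turn (a 0) (a 0)) = 1
    rw [← cos_turn_add_turn (ha 0) (ha 3) (ha 0), Real.cos_add, cos_turn_comm, h3]
    norm_num
  · exact h0 ▸ Real.cos_zero
  · change Real.cos (turn (a 0) (a 2)) = 1
    rw [← cos_turn_add_turn (ha 0) (ha 1) (ha 2), h0, h1, add_zero, Real.cos_zero]
  · exact cos_turn_comm (a 3) (a 0) ▸ h3 ▸ Real.cos_zero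

theorem exists_int_sum_turn {n : ℕ} [NeZero n] {a : Fin n → ℂ} (ha : ∀ i, a i ≠ 0) :
    ∃ m : ℤ, ∑ i, turn (a i) (a (i + 1)) = 2 * pi * m := by
  have hsum : ((∑ i, turn (a i) (a (i + 1)) : ℝ) : Real.Angle) = (0 : ℝ) := by
    have hshift := Equiv.sum_comp (Equiv.addRight (1 : Fin n))
      fun i => (Complex.arg (a i) : Real.Angle)
    rw [← Real.Angle.coe_coeHom, map_sum]
    simp only [Real.Angle.coe_coeHom, coe_turn (ha _) (ha _), Finset.sum_sub_distrib,
      Real.Angle.coe_zero, sub_eq_zero]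
    exact hshift
  obtain ⟨m, hm⟩ := Real.Angle.angle_eq_iff_two_pi_dvd_sub.1 hsum
  exact ⟨m, by rw [← hm, sub_zero]⟩

theorem two_le_norm_mul_norm (ha : 2 ≤ ‖a‖ ^ 2) (hb : 2 ≤ ‖b‖ ^ 2) : 2 ≤ ‖a‖ * ‖b‖ := by
  refine le_of_sq_le_sq ?_ (by positivity)
  rw [mul_pow]
  nlinarith

theorem abs_turn_lt (ha : 2 ≤ ‖a‖ ^ 2) (hb : 2 ≤ ‖b‖ ^ 2) (h : ‖a - b‖ ^ 2 ≤ 6.8121) :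
    |turn a b| < 3 * pi / 4 := by
  have hab := two_le_norm_mul_norm ha hb
  have h2 : 1.414 ≤ √2 := Real.le_sqrt_of_sq_le (by norm_num)
  rw [norm_sub_sq_eq_conj_mul_re, conj_mul_re_eq] at h
  by_contra! hle
  have hcos : Real.cos |turn a b| ≤ Real.cos (pi - pi / 4) :=
    Real.cos_le_cos_of_nonneg_of_le_pi (by linarith [Real.pi_pos]) (Complex.abs_arg_le_pi _)
      (by linarith)
  rw [Real.cos_abs, Real.cos_pi_sub, Real.cos_pi_div_four] at hcos
  nlinarith [sq_nonneg (‖a‖ - ‖b‖)]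

end Turn

section Shell

theorem sqrt_eight : √8 = 2 * √2 := by
  rw [show (8 : ℝ) = 2 ^ 2 * 2 by norm_num, Real.sqrt_mul (by positivity),
    Real.sqrt_sq two_pos.le]

theorem sqrt_two_gt : 1.4142 < √2 :=
  Real.lt_sqrt_of_sq_lt (by norm_num)

/-- The constraints on the cylindrical coordinates `(a, z)`, relative to an axis, of a point at
distance at least `√2` from the axis and of norm in `[2, √8)`, whose distance from the point of the
axis with height `√8` is at least `2`. -/
structure IsShellPoint (a : ℂ) (z : ℝ) : Prop where
  two_le_sq : 2 ≤ ‖a‖ ^ 2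
  four_le : 4 ≤ ‖a‖ ^ 2 + z ^ 2
  lt_eight : ‖a‖ ^ 2 + z ^ 2 < 8
  four_le_sub : 4 ≤ ‖a‖ ^ 2 + (z - √8) ^ 2

variable {a b : ℂ} {x y : ℝ}

theorem IsShellPoint.two_add_le (h : IsShellPoint a y) :
    2 + 2 * √2 * |y - √2| ≤ ‖a‖ ^ 2 + (y - √2) ^ 2 := by
  have h0 := h.four_le
  have h1 := h.four_le_sub
  have h2 : √2 ^ 2 = 2 := Real.sq_sqrt two_pos.le
  rw [sqrt_eight] at h1
  rcases abs_cases (y - √2) with ⟨habs, -⟩ | ⟨habs, -⟩ <;> rw [habs] <;> linarith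

theorem IsShellPoint.lt_sqrt_eight (h : IsShellPoint a y) : y < 2 * √2 :=
  sqrt_eight ▸ Real.lt_sqrt_of_sq_lt (by linarith [h.lt_eight, sq_nonneg ‖a‖])

theorem IsShellPoint.four_add_le (ha : IsShellPoint a y) (hb : IsShellPoint b x) (hy : 0 < y) :
    4 + 2 * √2 * |y - √2| ≤ ‖a‖ ^ 2 + ‖b‖ ^ 2 + (y - x) ^ 2 := by
  have hy' : |y - √2| ≤ √2 := abs_le.2 ⟨by linarith, by linarith [ha.lt_sqrt_eight]⟩
  have hmul : (y - √2) * (x - √2) ≤ √2 * |x - √2| := calc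
    (y - √2) * (x - √2) ≤ |(y - √2) * (x - √2)| := le_abs_self _
    _ = |y - √2| * |x - √2| := abs_mul _ _
    _ ≤ √2 * |x - √2| := mul_le_mul_of_nonneg_right hy' (abs_nonneg _)
  linarith [ha.two_add_le, hb.two_add_le]

theorem IsShellPoint.height_add_cos_le (ha : IsShellPoint a y) (hb : IsShellPoint b x)
    (hy : 0 < y) (hab : ‖a - b‖ ^ 2 + (y - x) ^ 2 ≤ 6.8121) (hcos : Real.cos (turn a b) ≤ 0) :
    2 * √2 * |y - √2| + 4 * -Real.cos (turn a b) ≤ 2.8121 := by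
  rw [norm_sub_sq_eq_conj_mul_re, conj_mul_re_eq] at hab
  linarith [ha.four_add_le hb hy,
    mul_le_mul_of_nonpos_right (two_le_norm_mul_norm ha.two_le_sq hb.two_le_sq) hcos]

theorem IsShellPoint.sq_le (hb : IsShellPoint b x) (hab : ‖a - b‖ ^ 2 + (y - x) ^ 2 ≤ 6.8121)
    (hcos : Real.cos (turn a b) ≤ 0) : ‖a‖ ^ 2 ≤ 4.8121 := by
  rw [norm_sub_sq_eq_conj_mul_re, conj_mul_re_eq] at hab
  linarith [hb.two_le_sq, sq_nonneg (y - x),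
    mul_nonpos_of_nonneg_of_nonpos (mul_nonneg (norm_nonneg a) (norm_nonneg b)) hcos]

theorem IsShellPoint.abs_turn_lt (ha : IsShellPoint a y) (hb : IsShellPoint b x)
    (hab : ‖a - b‖ ^ 2 + (y - x) ^ 2 ≤ 6.8121) : |turn a b| < 3 * pi / 4 :=
  _root_.abs_turn_lt ha.two_le_sq hb.two_le_sq (by linarith [sq_nonneg (y - x)])

theorem mul_pos_of_cos_turn_nonpos (h : 0 < y * x + (conj a * b).re)
    (hcos : Real.cos (turn a b) ≤ 0) : 0 < y * x := by
  rw [conj_mul_re_eq] at h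
  linarith [mul_nonpos_of_nonneg_of_nonpos (mul_nonneg (norm_nonneg a) (norm_nonneg b)) hcos]

theorem sq_add_sq_sub_lt {r s : ℝ} (hr : 0 ≤ r) (hs : 0 ≤ s) (hr2 : 2 ≤ r ^ 2) (hs2 : 2 ≤ s ^ 2)
    (hr' : r ^ 2 ≤ 4.8121) (hs' : s ^ 2 ≤ 4.8121) : r ^ 2 + s ^ 2 - 1.4142 * (r * s) < 3 := by
  have r_le : r ≤ 2.194 := by nlinarith
  have s_le : s ≤ 2.194 := by nlinarith
  have le_r : 1.414 ≤ r := by nlinarith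
  have le_s : 1.414 ≤ s := by nlinarith
  nlinarith [mul_nonneg (sub_nonneg.2 r_le) (sub_nonneg.2 s_le),
    mul_nonneg (sub_nonneg.2 le_r) (sub_nonneg.2 le_s),
    mul_nonneg (sub_nonneg.2 le_r) (sub_nonneg.2 s_le),
    mul_nonneg (sub_nonneg.2 le_s) (sub_nonneg.2 r_le)]

theorem cos_add_cos_le {s t : ℝ} (h : 5 * pi / 4 ≤ s + t) (hs : s ≤ 3 * pi / 4)
    (ht : t ≤ 3 * pi / 4) : Real.cos s + Real.cos t ≤ -(√2 / 2) := by
  have hpi := Real.pi_pos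
  have hadd : Real.cos ((s + t) / 2) ≤ -Real.sin (pi / 8) := by
    rw [← Real.cos_add_pi_div_two]
    exact Real.cos_le_cos_of_nonneg_of_le_pi (by linarith) (by linarith) (by linarith)
  have hsub : Real.cos (pi / 8) ≤ Real.cos ((s - t) / 2) := by
    rw [← Real.cos_abs ((s - t) / 2)]
    exact Real.cos_le_cos_of_nonneg_of_le_pi (abs_nonneg _) (by linarith)
      (abs_le.2 ⟨by linarith, by linarith⟩)
  have hdouble : 2 * Real.sin (pi / 8) * Real.cos (pi / 8) = √2 / 2 := by
    rw [← Real.sin_two_mul, ← Real.sin_pi_div_four]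
    ring_nf
  have hsin : 0 ≤ Real.sin (pi / 8) :=
    Real.sin_nonneg_of_nonneg_of_le_pi (by linarith) (by linarith)
  have hcos : 0 ≤ Real.cos (pi / 8) :=
    Real.cos_nonneg_of_neg_pi_div_two_le_of_le (by linarith) (by linarith)
  rw [Real.cos_add_cos]
  nlinarith [mul_le_mul (le_neg.2 hadd) hsub hcos (hsin.trans (le_neg.2 hadd))]

theorem pos_of_mul_pos_cyclic {z : Fin 4 → ℝ} (i : Fin 4) (h1 : 0 < z (i + 1) * z (i + 2))
    (h2 : 0 < z (i + 2) * z (i + 3)) (h3 : 0 < z (i + 3) * z i) (hz : ¬∀ j, z j < 0) :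
    0 < z i ∧ 0 < z (i + 1) := by
  have hi := (pos_iff_pos_of_mul_pos h2).trans (pos_iff_pos_of_mul_pos h3)
  rcases pos_and_pos_or_neg_and_neg_of_mul_pos h1 with ⟨hpos, hpos'⟩ | ⟨hneg, hneg'⟩
  · exact ⟨hi.1 hpos', hpos⟩
  · have hneg3 := (neg_iff_neg_of_mul_pos h2).1 hneg'
    exact absurd (forall_fin_four i ((neg_iff_neg_of_mul_pos h3).1 hneg3) hneg hneg' hneg3) hz

theorem dist_sq_lt_four {a₀ a₁ : ℂ} {y₀ y₁ c₀ c₁ : ℝ} (ha₀ : 2 ≤ ‖a₀‖ ^ 2) (ha₁ : 2 ≤ ‖a₁‖ ^ 2)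
    (ha₀' : ‖a₀‖ ^ 2 ≤ 4.8121) (ha₁' : ‖a₁‖ ^ 2 ≤ 4.8121) (hcos : √2 / 2 ≤ Real.cos (turn a₀ a₁))
    (h₀ : 2 * √2 * |y₀ - √2| + 4 * -c₀ ≤ 2.8121) (h₁ : 2 * √2 * |y₁ - √2| + 4 * -c₁ ≤ 2.8121)
    (hc : c₀ + c₁ ≤ -(√2 / 2)) : ‖a₀ - a₁‖ ^ 2 + (y₀ - y₁) ^ 2 < 4 := by
  have h2 := sqrt_two_gt
  have hnorm : 0 ≤ ‖a₀‖ * ‖a₁‖ := by positivity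
  have habs : |y₀ - y₁| ≤ 0.989 := by
    have : |y₀ - y₁| ≤ |y₀ - √2| + |y₁ - √2| :=
      sub_sub_sub_cancel_right y₀ y₁ √2 ▸ abs_sub (y₀ - √2) (y₁ - √2)
    nlinarith [abs_nonneg (y₀ - y₁)]
  have hsq : (y₀ - y₁) ^ 2 ≤ 0.989 ^ 2 := sq_le_sq' (abs_le.1 habs).1 (abs_le.1 habs).2
  rw [norm_sub_sq_eq_conj_mul_re, conj_mul_re_eq]
  linarith [sq_add_sq_sub_lt (norm_nonneg a₀) (norm_nonneg a₁) ha₀ ha₁ ha₀' ha₁',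
    mul_le_mul_of_nonneg_left hcos hnorm, mul_le_mul_of_nonneg_left h2.le hnorm]

theorem pi_div_two_lt_of_sum_eq_two_pi {θ : Fin 4 → ℝ} (hθ : ∀ j, θ j < 3 * pi / 4)
    (hsum : ∑ j, θ j = 2 * pi) {i j : Fin 4} (hi : θ i ≤ 0) (hj : j ≠ i) : pi / 2 < θ j := by
  have h1 := hθ (i + 1)
  have h2 := hθ (i + 2)
  have h3 := hθ (i + 3)
  rw [sum_fin_four θ i] at hsum
  refine forall_fin_four (P := fun j => j ≠ i → pi / 2 < θ j) i (absurd rfl) ?_ ?_ ?_ j hj <;>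
    intro _ <;> linarith

/-- If the edge turned backwards, the three others would turn by more than `π / 2` each; being
short, they would force the two ends of the backward edge to be too close to each other. -/
theorem turn_pos_of_sum_eq_two_pi {a : Fin 4 → ℂ} {z : Fin 4 → ℝ}
    (hshell : ∀ i, IsShellPoint (a i) (z i))
    (hlong : ∀ i, 4 ≤ ‖a i - a (i + 1)‖ ^ 2 + (z i - z (i + 1)) ^ 2)
    (hshort : ∀ i, ‖a i - a (i + 1)‖ ^ 2 + (z i - z (i + 1)) ^ 2 ≤ 6.8121)
    (hinner : ∀ i, 0 < z i * z (i + 1) + (conj (a i) * a (i + 1)).re) (hz : ¬∀ i, z i < 0)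
    (hsum : ∑ i, turn (a i) (a (i + 1)) = 2 * pi) (i : Fin 4) : 0 < turn (a i) (a (i + 1)) := by
  by_contra! hback
  have habs (j : Fin 4) : |turn (a j) (a (j + 1))| < 3 * pi / 4 :=
    (hshell j).abs_turn_lt (hshell (j + 1)) (hshort j)
  have hlt (j : Fin 4) : turn (a j) (a (j + 1)) < 3 * pi / 4 := (abs_lt.1 (habs j)).2
  have hgt : -(3 * pi / 4) < turn (a i) (a (i + 1)) := (abs_lt.1 (habs i)).1
  have hobtuse (j : Fin 4) (hj : j ≠ i) : Real.cos (turn (a j) (a (j + 1))) ≤ 0 :=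
    Real.cos_nonpos_of_pi_div_two_le_of_le (pi_div_two_lt_of_sum_eq_two_pi hlt hsum hback hj).le
      (by linarith [hlt j, Real.pi_pos])
  have hmul (j : Fin 4) (hj : j ≠ i) : 0 < z j * z (j + 1) :=
    mul_pos_of_cos_turn_nonpos (hinner j) (hobtuse j hj)
  have hlt1 := hlt (i + 1)
  have hlt2 := hlt (i + 2)
  have hlt3 := hlt (i + 3)
  have hmul1 := hmul (i + 1) (by simp)
  have hmul2 := hmul (i + 2) (by simp)
  have hmul3 := hmul (i + 3) (by simp)
  have obtuse1 := hobtuse (i + 1) (by simp)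
  have obtuse3 := hobtuse (i + 3) (by simp)
  have short1 := hshort (i + 1)
  have short3 := hshort (i + 3)
  rw [sum_fin_four _ i] at hsum
  simp only [add_assoc, Fin.reduceAdd, add_zero] at *
  obtain ⟨hz0, hz1⟩ := pos_of_mul_pos_cyclic i hmul1 hmul2 hmul3 hz
  have hforward : √2 / 2 ≤ Real.cos (turn (a i) (a (i + 1))) := by
    rw [← Real.cos_pi_div_four, ← Real.cos_neg (turn _ _)]
    exact Real.cos_le_cos_of_nonneg_of_le_pi (by linarith) (by linarith [Real.pi_pos])
      (by linarith)
  have hcos := cos_add_cos_le (s := turn (a (i + 3)) (a i)) (t := turn (a (i + 1)) (a (i + 2)))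
    (by linarith) (by linarith) (by linarith)
  rw [cos_turn_comm] at hcos obtuse3
  rw [norm_sub_rev, sub_sq_comm] at short3
  exact (hlong i).not_gt (dist_sq_lt_four (hshell i).two_le_sq (hshell (i + 1)).two_le_sq
    ((hshell (i + 3)).sq_le short3 obtuse3) ((hshell (i + 2)).sq_le short1 obtuse1) hforward
    ((hshell i).height_add_cos_le (hshell _) hz0 short3 obtuse3)
    ((hshell (i + 1)).height_add_cos_le (hshell _) hz1 short1 obtuse1) hcos)

end Shell

section Triple

/-- The cross product of two vectors of Euclidean three-space. -/
def cross (a b : R3) : R3 :=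
  WithLp.toLp 2 (crossProduct a.ofLp b.ofLp)

/-- The scalar triple product of three vectors of Euclidean three-space. -/
def triple (a b c : R3) : ℝ :=
  dotProduct a.ofLp (crossProduct b.ofLp c.ofLp)

variable (a b c d : R3)

theorem inner_eq_dotProduct : inner ℝ a b = dotProduct a.ofLp b.ofLp := by
  rw [EuclideanSpace.inner_eq_star_dotProduct, star_trivial, dotProduct_comm]

theorem inner_cross_right : inner ℝ a (cross b c) = triple a b c :=
  inner_eq_dotProduct _ _

theorem inner_cross_left : inner ℝ (cross b c) a = triple a b c := by
  rw [real_inner_comm, inner_cross_right]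

theorem inner_cross_cross : inner ℝ (cross a b) (cross c d) =
    inner ℝ a c * inner ℝ b d - inner ℝ a d * inner ℝ b c := by
  simp only [inner_eq_dotProduct]
  exact cross_dot_cross _ _ _ _

theorem cross_cross_right : cross a (cross b c) = inner ℝ a c • b - inner ℝ a b • c := by
  rw [inner_eq_dotProduct, inner_eq_dotProduct, dotProduct_comm a.ofLp b.ofLp]
  exact congrArg (WithLp.toLp 2) (cross_cross_eq_smul_sub_smul' a.ofLp b.ofLp c.ofLp)

theorem norm_cross_sq : ‖cross a b‖ ^ 2 = ‖a‖ ^ 2 * ‖b‖ ^ 2 - inner ℝ a b ^ 2 := by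
  rw [← real_inner_self_eq_norm_sq, inner_cross_cross, real_inner_self_eq_norm_sq,
    real_inner_self_eq_norm_sq, real_inner_comm a b, sq (inner ℝ a b)]

theorem triple_eq_coords : triple a b c = a 0 * (b 1 * c 2 - b 2 * c 1) +
    a 1 * (b 2 * c 0 - b 0 * c 2) + a 2 * (b 0 * c 1 - b 1 * c 0) := by
  simp only [triple, cross_apply, Matrix.vec3_dotProduct, Matrix.cons_val]

theorem triple_rotate : triple a b c = triple b c a :=
  triple_product_permutation _ _ _

theorem triple_swap : triple a c b = -triple a b c := by
  rw [triple, triple, ← cross_anticomm, dotProduct_neg]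

theorem triple_self_left : triple a a b = 0 :=
  dot_self_cross _ _

theorem triple_self_outer : triple a b a = 0 :=
  dot_cross_self _ _

theorem triple_neg_neg_neg : triple (-a) (-b) (-c) = -triple a b c := by
  simp only [triple, WithLp.ofLp_neg, map_neg, LinearMap.neg_apply, neg_neg, neg_dotProduct]

theorem triple_smul_left (t : ℝ) : triple (t • a) b c = t * triple a b c :=
  smul_dotProduct _ _ _

theorem triple_smul_eq (q : R3) : triple a b c • q =
    triple q b c • a + triple q c a • b + triple q a b • c := by
  ext i
  simp only [triple_eq_coords, PiLp.add_apply, PiLp.smul_apply, smul_eq_mul]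
  fin_cases i <;> simp only [Fin.zero_eta, Fin.mk_one, Fin.reduceFinMk] <;> ring

end Triple

section Cylindrical

theorem conj_mul_self_re (a : ℂ) : (conj a * a).re = ‖a‖ ^ 2 := by
  rw [← Complex.normSq_eq_conj_mul_self, Complex.ofReal_re, Complex.normSq_eq_norm_sq]

/-- The height of `a` along the axis directed by `q`. -/
noncomputable def height (q a : R3) : ℝ :=
  inner ℝ q a / ‖q‖

/-- `w` is the projection along `q` to the orthogonal plane, identified with the complex plane by
a direct isometry: together with `height q` it provides cylindrical coordinates. -/
structure IsCylindrical (q : R3) (w : R3 →ₗ[ℝ] ℂ) : Prop where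
  inner_eq : ∀ a b, inner ℝ a b = height q a * height q b + (conj (w a) * w b).re
  triple_eq : ∀ a b, triple q a b = ‖q‖ * (conj (w a) * w b).im

theorem exists_norm_eq_one_inner_eq_zero (q : R3) : ∃ e : R3, ‖e‖ = 1 ∧ inner ℝ q e = 0 := by
  obtain ⟨x, hx, hx0⟩ : ∃ x ∈ (ℝ ∙ q)ᗮ, x ≠ 0 := by
    refine Submodule.exists_mem_ne_zero_of_ne_bot fun hbot => ?_
    have hrank := Submodule.finrank_add_finrank_orthogonal (ℝ ∙ q)
    rw [hbot, finrank_bot, finrank_euclideanSpace_fin] at hrank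
    have hspan := finrank_span_le_card (R := ℝ) {q}
    rw [Set.toFinset_singleton, Finset.card_singleton] at hspan
    lia
  exact ⟨‖x‖⁻¹ • x, norm_smul_inv_norm hx0, by
    rw [real_inner_smul_right, Submodule.mem_orthogonal_singleton_iff_inner_right.1 hx, mul_zero]⟩

/-- With `e` a unit vector orthogonal to `q` and `f = cross q e`, the coordinates in the plane
orthogonal to `q` are the inner products with `e` and `‖q‖⁻¹ • f`. -/
theorem exists_isCylindrical {q : R3} (hq : q ≠ 0) : ∃ w, IsCylindrical q w := by
  obtain ⟨e, he, hqe⟩ := exists_norm_eq_one_inner_eq_zero q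
  set f := cross q e with hf
  have hq0 : ‖q‖ ≠ 0 := norm_ne_zero_iff.2 hq
  have cross_ef : cross e f = q := by
    rw [cross_cross_right, real_inner_self_eq_norm_sq, he, one_pow, one_smul, real_inner_comm, hqe,
      zero_smul, sub_zero]
  have cross_qf : cross q f = -(‖q‖ ^ 2 • e) := by
    rw [cross_cross_right, hqe, zero_smul, zero_sub, real_inner_self_eq_norm_sq]
  have triple_qef : triple q e f = ‖q‖ ^ 2 := by
    rw [← inner_cross_right, cross_ef, real_inner_self_eq_norm_sq]
  have inner_expand (a b : R3) : ‖q‖ ^ 2 * inner ℝ a b = inner ℝ q a * inner ℝ q b +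
      ‖q‖ ^ 2 * (inner ℝ e a * inner ℝ e b) + inner ℝ f a * inner ℝ f b := by
    have h := congrArg (inner ℝ · b) (triple_smul_eq q e f a)
    simp only [inner_add_left, real_inner_smul_left] at h
    rw [triple_qef, triple_swap a q f, ← inner_cross_right, ← inner_cross_right,
      ← inner_cross_right, cross_ef, cross_qf, ← hf, inner_neg_right, real_inner_smul_right,
      real_inner_comm q, real_inner_comm e, real_inner_comm f] at h
    linarith
  let w : R3 →ₗ[ℝ] ℂ := Complex.equivRealProdLm.symm.toLinearMap ∘ₗ
    (innerₛₗ ℝ e).prod (‖q‖⁻¹ • innerₛₗ ℝ f)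
  have w_re (a : R3) : (w a).re = inner ℝ e a := rfl
  have w_im (a : R3) : (w a).im = ‖q‖⁻¹ * inner ℝ f a := rfl
  refine ⟨w, fun a b => mul_left_cancel₀ (pow_ne_zero 2 hq0) ?_, fun a b => ?_⟩
  · rw [inner_expand, Complex.mul_re, Complex.conj_re, Complex.conj_im, w_re, w_re, w_im, w_im,
      height, height]
    field
  · have h := inner_cross_cross e f a b
    rw [cross_ef, inner_cross_right] at h
    rw [h, Complex.mul_im, Complex.conj_re, Complex.conj_im, w_re, w_re, w_im, w_im]
    field

variable {q : R3} {w : R3 →ₗ[ℝ] ℂ}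

theorem IsCylindrical.norm_sq (hw : IsCylindrical q w) (a : R3) :
    ‖a‖ ^ 2 = ‖w a‖ ^ 2 + height q a ^ 2 := by
  rw [← real_inner_self_eq_norm_sq, hw.inner_eq, conj_mul_self_re, add_comm, sq (height q a)]

theorem IsCylindrical.dist_sq (hw : IsCylindrical q w) (a b : R3) :
    dist a b ^ 2 = ‖w a - w b‖ ^ 2 + (height q a - height q b) ^ 2 := by
  rw [dist_eq_norm, hw.norm_sq, map_sub, height, height, height, inner_sub_right, sub_div]

theorem IsCylindrical.map_eq_zero (hw : IsCylindrical q w) : w q = 0 := by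
  rcases eq_or_ne q 0 with rfl | hq
  · exact map_zero w
  have h := hw.norm_sq q
  rw [height, real_inner_self_eq_norm_sq, sq ‖q‖, mul_div_cancel_right₀ _ (norm_ne_zero_iff.2 hq)]
    at h
  exact norm_eq_zero.1 (pow_eq_zero_iff two_ne_zero |>.1 (by linarith))

theorem IsCylindrical.triple_pos_iff (hw : IsCylindrical q w) (hq : q ≠ 0) {a b : R3} :
    0 < triple q a b ↔ 0 < (conj (w a) * w b).im := by
  rw [hw.triple_eq, mul_pos_iff_of_pos_left (norm_pos_iff.2 hq)]

end Cylindrical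

section Axis

variable {p : Fin 4 → R3} {q : R3} {w : R3 →ₗ[ℝ] ℂ}

theorem triple_mul_inner_eq (x y z q u : R3) : triple x y z * inner ℝ u q =
    triple q y z * inner ℝ u x + triple q z x * inner ℝ u y + triple q x y * inner ℝ u z := by
  rw [← real_inner_smul_right, triple_smul_eq]
  simp only [inner_add_right, real_inner_smul_right]

theorem eq_add_smul_of_triple_ne_zero {x y z : R3} (h : triple x y z ≠ 0) (q : R3) :
    q = (triple q y z / triple x y z) • x + ((triple q z x / triple x y z) • y +
      (triple q x y / triple x y z) • z) := by
  rw [div_eq_inv_mul, div_eq_inv_mul, div_eq_inv_mul, mul_smul, mul_smul, mul_smul, ← smul_add,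
    ← smul_add, ← add_assoc, ← triple_smul_eq, smul_smul, inv_mul_cancel₀ h, one_smul]

theorem triple_pos_of_triple_nonneg {x y z q u : R3} (hx : 0 < inner ℝ u x)
    (hy : 0 < inner ℝ u y) (hz : 0 < inner ℝ u z) (hq : 0 ≤ inner ℝ u q)
    (hyz : 0 ≤ triple q y z) (hzx : 0 ≤ triple q z x) (hxy : 0 < triple q x y) :
    0 < triple x y z := by
  refine pos_of_mul_pos_left ?_ hq
  rw [triple_mul_inner_eq]
  positivity

theorem eq_add_smul_of_triple_nonneg {x y z q u : R3} (hx : 0 < inner ℝ u x)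
    (hy : 0 < inner ℝ u y) (hz : 0 < inner ℝ u z) (hq : 0 ≤ inner ℝ u q)
    (hyz : 0 ≤ triple q y z) (hzx : 0 ≤ triple q z x) (hxy : 0 < triple q x y) :
    ∃ α β γ : ℝ, 0 ≤ α ∧ 0 ≤ β ∧ 0 < γ ∧ q = α • x + (β • y + γ • z) := by
  have hpos := triple_pos_of_triple_nonneg hx hy hz hq hyz hzx hxy
  exact ⟨_, _, _, div_nonneg hyz hpos.le, div_nonneg hzx hpos.le, div_pos hxy hpos,
    eq_add_smul_of_triple_ne_zero hpos.ne' q⟩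

theorem IsFrame.exists_inner_pos (hp : IsFrame p) (hd : InBidualCone p q) :
    ∃ u : R3, (∀ i, 0 < inner ℝ u (p i)) ∧ 0 ≤ inner ℝ u q :=
  hp.exists_hemisphere.imp fun u hu => ⟨hu, hd u hu⟩

theorem IsFrame.norm_sq_add_sq_le (hp : IsFrame p) (hw : IsCylindrical q w) (i : Fin 4) :
    ‖w (p i) - w (p (i + 1))‖ ^ 2 + (height q (p i) - height q (p (i + 1))) ^ 2 ≤ 6.8121 := by
  rw [← hw.dist_sq, dist_sq_eq]
  exact (le_sq_of_dist_le (hp.dist_le i)).trans_eq (by norm_num)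

theorem IsFrame.abs_turn_lt (hp : IsFrame p) (hw : IsCylindrical q w)
    (hr : ∀ i, 2 ≤ ‖w (p i)‖ ^ 2) (i : Fin 4) : |turn (w (p i)) (w (p (i + 1)))| < 3 * pi / 4 :=
  _root_.abs_turn_lt (hr i) (hr (i + 1)) (by
    linarith [hp.norm_sq_add_sq_le hw i, sq_nonneg (height q (p i) - height q (p (i + 1)))])

theorem IsAxis.four_le_norm_sq_add (hp : IsFrame p) (hq : IsAxis p q) (hw : IsCylindrical q w)
    (i : Fin 4) : 4 ≤ ‖w (p i)‖ ^ 2 + (height q (p i) - √8) ^ 2 := by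
  have hnorm : 0 < ‖q‖ := norm_pos_iff.2 hq.ne_zero
  have hinner := inner_le_norm_sq (hp.norm_lt i).le hq.two_le_norm (hq.two_le_dist i)
  have hdist : 2 ≤ dist (p i) ((√8 / ‖q‖) • q) :=
    (hq.two_le_dist i).trans (dist_le_dist_smul ((one_le_div hnorm).2 hq.norm_le) hinner)
  have hheight : height q ((√8 / ‖q‖) • q) = √8 := by
    rw [height, real_inner_smul_right, real_inner_self_eq_norm_sq]
    field
  have hsq := four_le_sq hdist
  rwa [hw.dist_sq, map_smul, hw.map_eq_zero, smul_zero, sub_zero, hheight] at hsq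

theorem IsAxis.isShellPoint (hp : IsFrame p) (hq : IsAxis p q) (hw : IsCylindrical q w)
    {i : Fin 4} (hr : 2 ≤ ‖w (p i)‖ ^ 2) : IsShellPoint (w (p i)) (height q (p i)) where
  two_le_sq := hr
  four_le := hw.norm_sq (p i) ▸ four_le_sq (hp.two_le_norm i)
  lt_eight := hw.norm_sq (p i) ▸ norm_sq_lt_eight (hp.norm_lt i)
  four_le_sub := hq.four_le_norm_sq_add hp hw i

theorem two_le_sq_of_neg_lt {r z n : ℝ} (hsum : n ^ 2 = r ^ 2 + z ^ 2)
    (hn4 : 4 ≤ n ^ 2) (hn8 : n ^ 2 < 8) (hsub : 4 ≤ r ^ 2 + (z - √8) ^ 2)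
    (hz : -(√2 / 2 * n) < z) : 2 ≤ r ^ 2 := by
  have h2 : √2 ^ 2 = 2 := Real.sq_sqrt two_pos.le
  have hpos : 0 < √2 := by positivity
  rw [sqrt_eight] at hsub
  by_contra! hr
  rcases le_or_gt z 0 with hz0 | hz0
  · have hz2 : z ^ 2 < (√2 / 2 * n) ^ 2 :=
      sq_lt_sq' hz (hz0.trans_lt (by linarith))
    rw [mul_pow, div_pow, h2] at hz2
    linarith
  · have hlow : √2 < z := by nlinarith
    nlinarith

theorem IsAxis.two_le_norm_sq_of_eq_add (hp : IsFrame p) (hq : IsAxis p q)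
    (hw : IsCylindrical q w) {i j m : Fin 4} {α β γ : ℝ} (hα : 0 ≤ α) (hβ : 0 ≤ β) (hγ : 0 ≤ γ)
    (h : q = α • p i + (β • p j + γ • p m)) (hij : dist (p i) (p j) ≤ 2.61)
    (hjm : dist (p j) (p m) ≤ 2.61) : 2 ≤ ‖w (p i)‖ ^ 2 := by
  have hinner := inner_gt_of_eq_add hα hβ hγ h (hp.two_le_norm i) (hp.two_le_norm j)
    (hp.two_le_norm m) (hp.norm_lt m).le hq.two_le_norm hq.norm_le hij hjm (hq.two_le_dist m)
  have hheight : -(√2 / 2 * ‖p i‖) < height q (p i) := by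
    rw [height, lt_div_iff₀ (norm_pos_iff.2 hq.ne_zero), real_inner_comm]
    linarith
  exact two_le_sq_of_neg_lt (hw.norm_sq _) (four_le_sq (hp.two_le_norm i))
    (norm_sq_lt_eight (hp.norm_lt i)) (hq.four_le_norm_sq_add hp hw i) hheight

theorem IsAxis.two_le_norm_sq_of_triple_nonneg (hp : IsFrame p) (hq : IsAxis p q)
    (hd : InBidualCone p q) (hw : IsCylindrical q w) {i : Fin 4}
    (h0 : 0 < triple q (p i) (p (i + 1))) (h1 : 0 ≤ triple q (p (i + 1)) (p (i + 2)))
    (h2 : 0 ≤ triple q (p (i + 2)) (p i)) :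
    2 ≤ ‖w (p i)‖ ^ 2 ∧ 2 ≤ ‖w (p (i + 2))‖ ^ 2 := by
  obtain ⟨u, hu, huq⟩ := hp.exists_inner_pos hd
  obtain ⟨α, β, γ, hα, hβ, hγ, h⟩ :=
    eq_add_smul_of_triple_nonneg (hu i) (hu (i + 1)) (hu (i + 2)) huq h1 h2 h0
  have dist0 := hp.dist_le i
  have dist1 := hp.dist_le (i + 1)
  simp only [add_assoc, Fin.reduceAdd] at dist1
  refine ⟨hq.two_le_norm_sq_of_eq_add hp hw hα hβ hγ.le h dist0 dist1, ?_⟩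
  rw [dist_comm] at dist0 dist1
  exact hq.two_le_norm_sq_of_eq_add hp hw hγ.le hβ hα (h.trans (by abel)) dist1 dist0

theorem not_forall_height_neg (hq0 : q ≠ 0) (hd : InBidualCone p q) :
    ¬∀ i, height q (p i) < 0 := fun hneg => by
  have hpos : 0 < ‖q‖ := norm_pos_iff.2 hq0
  have h := hd (-q) fun i => by
    rw [inner_neg_left, neg_pos]
    exact lt_of_not_ge fun h => (hneg i).not_ge (div_nonneg h hpos.le)
  rw [inner_neg_left, real_inner_self_eq_norm_sq] at h
  linarith [pow_pos hpos 2]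

theorem IsAxis.turn_pos_of_sum (hp : IsFrame p) (hq : IsAxis p q) (hd : InBidualCone p q)
    (hw : IsCylindrical q w) (hr : ∀ i, 2 ≤ ‖w (p i)‖ ^ 2)
    (hsum : ∑ i, turn (w (p i)) (w (p (i + 1))) = 2 * pi) (i : Fin 4) :
    0 < turn (w (p i)) (w (p (i + 1))) := by
  refine turn_pos_of_sum_eq_two_pi (a := fun i => w (p i)) (z := fun i => height q (p i))
    (fun i => hq.isShellPoint hp hw (hr i)) (fun i => ?_) (fun i => hp.norm_sq_add_sq_le hw i)
    (fun i => hw.inner_eq (p i) (p (i + 1)) ▸ hp.inner_pos i)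
    (not_forall_height_neg hq.ne_zero hd) hsum i
  rw [← hw.dist_sq]
  exact four_le_sq (hp.two_le_dist i (i + 1) (by fin_cases i <;> decide))

end Axis

section Encircles

/-- The closed quadrilateral `p` winds once counterclockwise around the half-line from `0` through
`q`, without turning backwards. -/
structure Encircles (p : Fin 4 → R3) (q : R3) : Prop where
  triple_pos : ∀ i, 0 < triple q (p i) (p (i + 1))
  inBidualCone : InBidualCone p q

variable {p : Fin 4 → R3} {q : R3} {w : R3 →ₗ[ℝ] ℂ}

theorem Encircles.two_le_norm_sq (he : Encircles p q) (hp : IsFrame p) (hq : IsAxis p q)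
    (hw : IsCylindrical q w) (i : Fin 4) : 2 ≤ ‖w (p i)‖ ^ 2 := by
  have h1 := he.triple_pos (i + 1)
  have h2 := he.triple_pos (i + 2)
  have h3 := he.triple_pos (i + 3)
  have hcone := hq.two_le_norm_sq_of_triple_nonneg hp he.inBidualCone hw (i := i + 2)
  simp only [add_assoc, Fin.reduceAdd, add_zero] at h1 h2 h3 hcone
  rcases le_total 0 (triple q (p (i + 2)) (p i)) with h | h
  · exact (hq.two_le_norm_sq_of_triple_nonneg hp he.inBidualCone hw (he.triple_pos i) h1.le h).1
  · exact (hcone h2 h3.le (triple_swap q (p (i + 2)) (p i) ▸ neg_nonneg.2 h)).2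

theorem Encircles.of_sum_turn (hp : IsFrame p) (hq : IsAxis p q) (hd : InBidualCone p q)
    (hw : IsCylindrical q w) (h0 : ∀ i, w (p i) ≠ 0)
    (hlt : ∀ i, turn (w (p i)) (w (p (i + 1))) < pi)
    (hsum : ∑ i, turn (w (p i)) (w (p (i + 1))) = 2 * pi) : Encircles p q := by
  have triple_of_turn {i : Fin 4} (h : 0 < turn (w (p i)) (w (p (i + 1)))) :
      0 < triple q (p i) (p (i + 1)) :=
    (hw.triple_pos_iff hq.ne_zero).2 (turn_pos_and_lt_pi_iff.1 ⟨h, hlt i⟩)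
  suffices h : ∀ i, 0 < turn (w (p i)) (w (p (i + 1))) from ⟨fun i => triple_of_turn (h i), hd⟩
  by_contra! ⟨i, hi⟩
  refine hi.not_gt (hq.turn_pos_of_sum hp hd hw ?_ hsum i)
  have hlt1 := hlt (i + 1)
  have hlt2 := hlt (i + 2)
  have hlt3 := hlt (i + 3)
  have htriple1 := triple_of_turn (i := i + 1)
  have htriple2 := triple_of_turn (i := i + 2)
  have htriple3 := triple_of_turn (i := i + 3)
  have hcone1 := hq.two_le_norm_sq_of_triple_nonneg hp hd hw (i := i + 1)
  have hcone2 := hq.two_le_norm_sq_of_triple_nonneg hp hd hw (i := i + 2)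
  rw [sum_fin_four _ i] at hsum
  simp only [add_assoc, Fin.reduceAdd, add_zero] at *
  have triple31 : 0 < triple q (p (i + 3)) (p (i + 1)) :=
    (hw.triple_pos_iff hq.ne_zero).2 (conj_mul_im_pos_of_turn_add (h0 _) (h0 (i + 2)) (h0 _)
      (by linarith) (by linarith))
  have triple02 : 0 < triple q (p i) (p (i + 2)) :=
    (hw.triple_pos_iff hq.ne_zero).2 (conj_mul_im_pos_of_turn_add (h0 _) (h0 (i + 3)) (h0 _)
      (by linarith) (by linarith))
  have triple23 := htriple2 (by linarith)
  have hcone1' := hcone1 (htriple1 (by linarith)) triple23.le triple31.le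
  have hcone2' := hcone2 triple23 (htriple3 (by linarith)).le triple02.le
  exact forall_fin_four i hcone2'.2 hcone1'.1 hcone2'.1 hcone1'.2

theorem ne_zero_of_two_le_norm_sq {a : ℂ} (h : 2 ≤ ‖a‖ ^ 2) : a ≠ 0 := by
  rintro rfl
  norm_num at h

theorem IsFrame.sum_turn_eq (hp : IsFrame p) (hw : IsCylindrical q w)
    (hr : ∀ i, 2 ≤ ‖w (p i)‖ ^ 2) (h : ∀ i, 0 ≤ turn (w (p i)) (w (p (i + 1)))) :
    ∑ i, turn (w (p i)) (w (p (i + 1))) = 0 ∨ ∑ i, turn (w (p i)) (w (p (i + 1))) = 2 * pi := by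
  have hpi := Real.pi_pos
  obtain ⟨m, hm⟩ := exists_int_sum_turn (a := fun i => w (p i))
    fun i => ne_zero_of_two_le_norm_sq (hr i)
  have hnonneg : 0 ≤ 2 * pi * m := hm ▸ Finset.sum_nonneg fun i _ => h i
  have hlt : 2 * pi * m < 2 * pi * 2 := calc
    2 * pi * m = ∑ i, turn (w (p i)) (w (p (i + 1))) := hm.symm
    _ ≤ ∑ _i : Fin 4, 3 * pi / 4 :=
      Finset.sum_le_sum fun i _ => (abs_lt.1 (hp.abs_turn_lt hw hr i)).2.le
    _ = 3 * pi := by rw [Fin.sum_const, nsmul_eq_mul]; ring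
    _ < 2 * pi * 2 := by linarith
  have hm0 : 0 ≤ m := by
    exact_mod_cast (mul_nonneg_iff_of_pos_left (by positivity)).1 hnonneg
  have hm2 : m < 2 := by
    exact_mod_cast lt_of_mul_lt_mul_left hlt (by positivity)
  rw [hm]
  interval_cases m
  · exact Or.inl (by norm_num)
  · exact Or.inr (by norm_num)

theorem exists_conj_mul_re_lt_two (hp : IsFrame p) (hq : IsAxis p q) (hd : InBidualCone p q)
    (hw : IsCylindrical q w) (j : Fin 4) : ∃ i, (conj (w (p j)) * w (p i)).re < 2 := by
  by_contra! hre
  have hnorm : 0 < ‖q‖ := norm_pos_iff.2 hq.ne_zero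
  have hinner (i : Fin 4) : inner ℝ q (p i) < 8 := by
    linarith [norm_sq_lt_eight (hp.norm_lt i), norm_sq_le_eight hq.norm_le,
      sq_nonneg (‖q‖ - ‖p i‖), real_inner_le_norm q (p i)]
  -- This vector is the projection of `p j` along `q` to the plane `q^⊥`, tilted slightly away
  -- from `q`.
  have h := hd (p j - (height q (p j) / ‖q‖ + 1 / 8) • q) fun i => by
    have hheight : height q (p j) / ‖q‖ * inner ℝ q (p i) = height q (p j) * height q (p i) := by
      rw [height, height]
      field
    rw [inner_sub_left, real_inner_smul_left, add_mul, hheight, hw.inner_eq]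
    linarith [hre i, hinner i]
  have hheight : (height q (p j) / ‖q‖ + 1 / 8) * ‖q‖ ^ 2 = inner ℝ q (p j) + ‖q‖ ^ 2 / 8 := by
    rw [height]
    field
  rw [inner_sub_left, real_inner_smul_left, real_inner_self_eq_norm_sq, hheight,
    real_inner_comm] at h
  linarith [pow_pos hnorm 2]

theorem Encircles.of_triple_nonneg (hp : IsFrame p) (hq : IsAxis p q) (hd : InBidualCone p q)
    (hw : IsCylindrical q w) (hr : ∀ i, 2 ≤ ‖w (p i)‖ ^ 2)
    (h : ∀ i, 0 ≤ triple q (p i) (p (i + 1))) : Encircles p q := by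
  have hne (i : Fin 4) : w (p i) ≠ 0 := ne_zero_of_two_le_norm_sq (hr i)
  have hturn (i : Fin 4) : 0 ≤ turn (w (p i)) (w (p (i + 1))) :=
    Complex.arg_nonneg_iff.2 (nonneg_of_mul_nonneg_right (hw.triple_eq _ _ ▸ h i)
      (norm_pos_iff.2 hq.ne_zero))
  rcases hp.sum_turn_eq hw hr hturn with hsum | hsum
  · have hzero (i : Fin 4) : turn (w (p i)) (w (p (i + 1))) = 0 :=
      (Finset.sum_eq_zero_iff_of_nonneg fun i _ => hturn i).1 hsum i (Finset.mem_univ i)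
    obtain ⟨i, hi⟩ := exists_conj_mul_re_lt_two hp hq hd hw 0
    rw [conj_mul_re_eq, cos_turn_zero_eq_one hne hzero, mul_one] at hi
    exact absurd hi (two_le_norm_mul_norm (hr 0) (hr i)).not_gt
  · exact .of_sum_turn hp hq hd hw hne
      (fun i => by linarith [(abs_lt.1 (hp.abs_turn_lt hw hr i)).2, Real.pi_pos]) hsum

theorem Encircles.turn_pos (he : Encircles p q) (hq : IsAxis p q) (hw : IsCylindrical q w)
    (i : Fin 4) : 0 < turn (w (p i)) (w (p (i + 1))) :=
  (turn_pos_and_lt_pi_iff.2 ((hw.triple_pos_iff hq.ne_zero).1 (he.triple_pos i))).1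

theorem Encircles.sum_turn (he : Encircles p q) (hp : IsFrame p) (hq : IsAxis p q)
    (hw : IsCylindrical q w) : ∑ i, turn (w (p i)) (w (p (i + 1))) = 2 * pi :=
  (hp.sum_turn_eq hw (he.two_le_norm_sq hp hq hw) fun i => (he.turn_pos hq hw i).le).resolve_left
    (Finset.sum_pos (fun i _ => he.turn_pos hq hw i) Finset.univ_nonempty).ne'

theorem Encircles.conj_mul_re_neg (he : Encircles p q) (hp : IsFrame p) (hq : IsAxis p q)
    (hw : IsCylindrical q w) (i : Fin 4) : (conj (w (p i)) * w (p (i + 2))).re < 0 := by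
  have hr := he.two_le_norm_sq hp hq hw
  have hne (i : Fin 4) : w (p i) ≠ 0 := ne_zero_of_two_le_norm_sq (hr i)
  have hlt (i : Fin 4) := (abs_lt.1 (hp.abs_turn_lt hw hr i)).2
  have hsum := he.sum_turn hp hq hw
  have hlt1 := hlt (i + 1)
  have hlt2 := hlt (i + 2)
  have hlt3 := hlt (i + 3)
  rw [sum_fin_four _ i] at hsum
  simp only [add_assoc, Fin.reduceAdd, add_zero] at hsum hlt1 hlt2 hlt3
  have hcos :
      Real.cos (turn (w (p i)) (w (p (i + 1))) + turn (w (p (i + 1))) (w (p (i + 2)))) < 0 :=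
    Real.cos_neg_of_pi_div_two_lt_of_lt (by linarith) (by linarith [hlt i])
  rw [conj_mul_re_eq, ← cos_turn_add_turn (hne _) (hne (i + 1)) (hne _)]
  exact mul_neg_of_pos_of_neg (mul_pos (norm_pos_iff.2 (hne _)) (norm_pos_iff.2 (hne _))) hcos

theorem Encircles.two_lt_dist (he : Encircles p q) (hp : IsFrame p) (hq : IsAxis p q) (i : Fin 4) :
    2 < dist (p i) (p (i + 2)) := by
  obtain ⟨w, hw⟩ := exists_isCylindrical hq.ne_zero
  have hr := he.two_le_norm_sq hp hq hw
  refine lt_of_pow_lt_pow_left₀ 2 dist_nonneg ?_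
  rw [hw.dist_sq, norm_sub_sq_eq_conj_mul_re]
  linarith [hr i, hr (i + 2), he.conj_mul_re_neg hp hq hw i,
    sq_nonneg (height q (p i) - height q (p (i + 2)))]

end Encircles

section RadonPartition

variable {E : Type*} [NormedAddCommGroup E] [InnerProductSpace ℝ E] {q x a b v : E} {u r s : ℝ}

/-- The Radon partition of the points `0`, `a`, `b`, `q`, `x` in which the open segment from `q` to
`x` meets the triangle `0ab`, with the barycentric coordinates of the common point. -/
structure SegmentMeetsTriangle (q x a b : E) (u r s : ℝ) : Prop where
  pos : 0 < u
  lt_one : u < 1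
  left_pos : 0 < r
  right_pos : 0 < s
  add_le_one : r + s ≤ 1
  eq : (1 - u) • q + u • x = r • a + s • b

namespace SegmentMeetsTriangle

theorem combination_dist_sq (h : SegmentMeetsTriangle q x a b u r s) (v : E) :
    r * dist v a ^ 2 + s * dist v b ^ 2 + (1 - r - s) * ‖v‖ ^ 2 =
      ‖v‖ ^ 2 - 2 * ((1 - u) * inner ℝ v q + u * inner ℝ v x) +
        (r * ‖a‖ ^ 2 + s * ‖b‖ ^ 2) := by
  have hv := congrArg (inner ℝ v) h.eq
  simp only [inner_add_right, real_inner_smul_right] at hv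
  rw [hv, dist_sq_eq, dist_sq_eq]
  ring

theorem four_le (h : SegmentMeetsTriangle q x a b u r s) (hv : 2 ≤ ‖v‖) (ha : 2 ≤ dist v a)
    (hb : 2 ≤ dist v b) : 4 ≤ ‖v‖ ^ 2 - 2 * ((1 - u) * inner ℝ v q + u * inner ℝ v x) +
      (r * ‖a‖ ^ 2 + s * ‖b‖ ^ 2) := by
  rw [← h.combination_dist_sq]
  linarith [mul_le_mul_of_nonneg_left (four_le_sq ha) h.left_pos.le,
    mul_le_mul_of_nonneg_left (four_le_sq hb) h.right_pos.le,
    mul_le_mul_of_nonneg_left (four_le_sq hv) (sub_nonneg.2 h.add_le_one)]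

theorem le_of_dist_le (h : SegmentMeetsTriangle q x a b u r s) (hv : ‖v‖ < √8)
    (ha : dist v a ≤ 2.61) (hb : dist v b ≤ 2.61) :
    ‖v‖ ^ 2 - 2 * ((1 - u) * inner ℝ v q + u * inner ℝ v x) + (r * ‖a‖ ^ 2 + s * ‖b‖ ^ 2) ≤
      (r + s) * 6.8121 + (1 - (r + s)) * 8 := by
  rw [← h.combination_dist_sq]
  linarith [mul_le_mul_of_nonneg_left (pow_le_pow_left₀ dist_nonneg ha 2) h.left_pos.le,
    mul_le_mul_of_nonneg_left (pow_le_pow_left₀ dist_nonneg hb 2) h.right_pos.le,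
    mul_le_mul_of_nonneg_left (norm_sq_lt_eight hv).le (sub_nonneg.2 h.add_le_one)]

end SegmentMeetsTriangle

theorem inner_bounds_of_barycentric {X Q m u c P : ℝ} (hu : 0 < u) (hu1 : u < 1) (hc : c ≤ 1)
    (hP : P ≤ c * X) (h1 : 4 ≤ Q - 2 * ((1 - u) * Q + u * m) + P)
    (h2 : 4 ≤ X - 2 * ((1 - u) * m + u * X) + P) (hd : X - 2 * m + Q ≤ 8)
    (hX : 4 ≤ X) (hX' : X < 8) (hQ : 4 ≤ Q) : 0 ≤ m ∧ m ≤ X - 4 ∧ Q ≤ X := by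
  have hPX : P ≤ X := by nlinarith
  have : m ≤ Q := by
    by_contra! hlt
    nlinarith
  have hmX : m ≤ X - 4 := by
    rcases le_or_gt u (1 / 2) with h | h
    · nlinarith
    · by_contra! hlt
      nlinarith
  exact ⟨by linarith, hmX, by linarith⟩

theorem SegmentMeetsTriangle.inner_bounds (h : SegmentMeetsTriangle q x a b u r s) (hq : 2 ≤ ‖q‖)
    (hx : 2 ≤ ‖x‖) (hx8 : ‖x‖ < √8) (hax : ‖a‖ ≤ ‖x‖) (hbx : ‖b‖ ≤ ‖x‖) (hqx : dist q x ≤ √8)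
    (hqa : 2 ≤ dist q a) (hqb : 2 ≤ dist q b) (hxa : 2 ≤ dist x a) (hxb : 2 ≤ dist x b) :
    0 ≤ inner ℝ q x ∧ inner ℝ q x ≤ ‖x‖ ^ 2 - 4 ∧ ‖q‖ ^ 2 ≤ ‖x‖ ^ 2 := by
  have hP : r * ‖a‖ ^ 2 + s * ‖b‖ ^ 2 ≤ (r + s) * ‖x‖ ^ 2 := by
    rw [add_mul]
    exact add_le_add
      (mul_le_mul_of_nonneg_left (pow_le_pow_left₀ (norm_nonneg a) hax 2) h.left_pos.le)
      (mul_le_mul_of_nonneg_left (pow_le_pow_left₀ (norm_nonneg b) hbx 2) h.right_pos.le)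
  have h1 := h.four_le hq hqa hqb
  have h2 := h.four_le hx hxa hxb
  have hd := le_sq_of_dist_le hqx
  rw [Real.sq_sqrt (by norm_num)] at hd
  rw [real_inner_self_eq_norm_sq] at h1 h2
  rw [real_inner_comm] at h2
  exact inner_bounds_of_barycentric h.pos h.lt_one h.add_le_one hP h1 h2 (by linarith)
    (four_le_sq hx) (norm_sq_lt_eight hx8) (four_le_sq hq)

end RadonPartition

section Height

theorem mul_div_le_of_inner_bounds {A X Q m y : ℝ} (hA : 4 ≤ A) (hX : X < 8) (hQ : 4 ≤ Q)
    (hm : 0 ≤ m) (hmX : m ≤ X - 4) (hy : 4 ≤ A - 2 * y + Q) : 2 * (y * m / Q) ≤ A + X - 8 := by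
  suffices h : y * m / Q ≤ (A + X - 8) / 2 by linarith
  rw [div_le_iff₀ (by linarith)]
  have hym : y * m ≤ (A + Q - 4) / 2 * m := mul_le_mul_of_nonneg_right (by linarith) hm
  have hmul : (A + Q - 4) / 2 * m ≤ (A + Q - 4) / 2 * (X - 4) :=
    mul_le_mul_of_nonneg_left hmX (by linarith)
  nlinarith [mul_nonneg (sub_nonneg.2 hA) (show 0 ≤ Q - (X - 4) by linarith)]

theorem lt_of_radial_le_neg_two {X Q m u P C x y ρ c : ℝ} (hu : 0 < u) (hu1 : u < 1) (hc : 0 < c)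
    (h1 : 4 ≤ Q - 2 * ((1 - u) * Q + u * m) + P) (hd : X - 2 * m + Q ≤ 8) (hQ : 4 ≤ Q)
    (hm : 0 ≤ m) (hmQ : m ≤ Q) (hQX : Q ≤ X) (hC : 4 ≤ C) (hCx : 4 ≤ C - 2 * x + Q)
    (hy : y = x * m / Q + ρ) (hρ : ρ ≤ -2) :
    c * 6.8121 + (1 - c) * 8 < C - 2 * ((1 - u) * x + u * y) + P := by
  have hQ0 : 0 < Q := by linarith
  set k := (1 - u) + u * (m / Q) with hk
  have hk0 : 0 ≤ k := add_nonneg (by linarith) (mul_nonneg hu.le (div_nonneg hm hQ0.le))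
  have hk1 : k ≤ 1 := by
    linarith [mul_le_mul_of_nonneg_left ((div_le_one hQ0).2 hmQ) hu.le]
  have hxy : (1 - u) * x + u * y = k * x + u * ρ := by rw [hy, hk]; ring
  have hkQ : k * Q = (1 - u) * Q + u * m := by rw [hk]; field
  have hkx : 4 - k * Q ≤ C - 2 * (k * x) := by
    nlinarith [mul_nonneg hk0 (sub_nonneg.2 hCx), mul_nonneg (sub_nonneg.2 hk1) (sub_nonneg.2 hC)]
  rw [hxy]
  nlinarith [mul_nonneg hu.le (show 0 ≤ -2 - ρ by linarith),
    mul_nonneg hu.le (show 0 ≤ 8 - (X - 2 * m + Q) by linarith),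
    mul_nonneg hu.le (sub_nonneg.2 hQX)]

variable {q : R3} {w : R3 →ₗ[ℝ] ℂ}

theorem height_mul_height (q a b : R3) :
    height q a * height q b = inner ℝ q a * inner ℝ q b / ‖q‖ ^ 2 := by
  rw [height, height, div_mul_div_comm, sq]

theorem IsCylindrical.conj_mul_re_pos_of_inner_bounds {a x : R3} (hw : IsCylindrical q w)
    (hq : 2 ≤ ‖q‖) (ha : 2 ≤ ‖a‖) (hx : ‖x‖ < √8) (hm : 0 ≤ inner ℝ q x)
    (hm' : inner ℝ q x ≤ ‖x‖ ^ 2 - 4) (haq : 2 ≤ dist q a) (hax : dist a x ≤ 2.61) :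
    0 < (conj (w a) * w x).re := by
  have hheight := mul_div_le_of_inner_bounds (four_le_sq ha) (norm_sq_lt_eight hx)
    (four_le_sq hq) hm hm' (y := inner ℝ q a) (by linarith [sq_le_of_le_dist two_pos.le haq])
  rw [← height_mul_height] at hheight
  linarith [le_sq_of_dist_le hax, hw.inner_eq a x]

theorem IsCylindrical.four_le_norm_sq_of_inner_bounds {x : R3} (hw : IsCylindrical q w)
    (hq : 2 ≤ ‖q‖) (hx : ‖x‖ < √8) (hm : 0 ≤ inner ℝ q x) (hm' : inner ℝ q x ≤ ‖x‖ ^ 2 - 4) :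
    4 ≤ ‖w x‖ ^ 2 := by
  have hheight : height q x * height q x ≤ ‖x‖ ^ 2 - 4 := by
    rw [height_mul_height, div_le_iff₀ (by positivity)]
    exact mul_le_mul hm' (by linarith [four_le_sq hq, norm_sq_lt_eight hx]) hm (hm.trans hm')
  linarith [hw.norm_sq x, sq (height q x)]

end Height

section FacePlane

variable {p : Fin 4 → R3} {q : R3} {w : R3 →ₗ[ℝ] ℂ}

theorem Encircles.abs_turn_add_turn_sub_pi_le (he : Encircles p q) (hp : IsFrame p)
    (hq : IsAxis p q) (hw : IsCylindrical q w) {i : Fin 4}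
    (h0 : 0 < (conj (w (p i)) * w (p (i + 1))).re)
    (h3 : 0 < (conj (w (p (i + 3))) * w (p i)).re) :
    |turn (w (p (i + 2))) (w (p (i + 3))) + turn (w (p (i + 3))) (w (p i)) - pi| ≤ pi / 4 := by
  have hlt (i : Fin 4) := (abs_lt.1 (hp.abs_turn_lt hw (he.two_le_norm_sq hp hq hw) i)).2
  have hlt1 := hlt (i + 1)
  have hlt2 := hlt (i + 2)
  have hsum := he.sum_turn hp hq hw
  rw [sum_fin_four _ i] at hsum
  simp only [add_assoc, Fin.reduceAdd, add_zero] at hsum hlt1 hlt2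
  have hacute0 := (abs_lt.1 (Complex.abs_arg_lt_pi_div_two_iff.2 (Or.inl h0))).2
  have hacute3 := (abs_lt.1 (Complex.abs_arg_lt_pi_div_two_iff.2 (Or.inl h3))).2
  rw [← turn] at hacute0 hacute3
  exact abs_le.2 ⟨by linarith, by linarith⟩

theorem Encircles.conj_mul_re_le_neg_two (he : Encircles p q) (hp : IsFrame p) (hq : IsAxis p q)
    (hw : IsCylindrical q w) {i : Fin 4} (h0 : 0 < (conj (w (p i)) * w (p (i + 1))).re)
    (h3 : 0 < (conj (w (p (i + 3))) * w (p i)).re) (hr : 4 ≤ ‖w (p i)‖ ^ 2) :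
    (conj (w (p (i + 2))) * w (p i)).re ≤ -2 := by
  have hrad := he.two_le_norm_sq hp hq hw
  have hne (i : Fin 4) : w (p i) ≠ 0 := ne_zero_of_two_le_norm_sq (hrad i)
  have hcos : Real.cos (turn (w (p (i + 2))) (w (p i))) ≤ -(√2 / 2) := by
    rw [← cos_turn_add_turn (hne _) (hne (i + 3)) (hne _), ← Real.cos_pi_div_four, le_neg,
      ← Real.cos_sub_pi, ← Real.cos_abs (_ - pi)]
    exact Real.cos_le_cos_of_nonneg_of_le_pi (abs_nonneg _) (by linarith [Real.pi_pos])
      (he.abs_turn_add_turn_sub_pi_le hp hq hw h0 h3)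
  have hmul : √2 * 2 ≤ ‖w (p (i + 2))‖ * ‖w (p i)‖ := by
    gcongr
    · exact Real.sqrt_le_iff.2 ⟨norm_nonneg _, hrad _⟩
    · exact le_of_sq_le_sq (by linarith) (norm_nonneg _)
  calc (conj (w (p (i + 2))) * w (p i)).re
      = ‖w (p (i + 2))‖ * ‖w (p i)‖ * Real.cos (turn (w (p (i + 2))) (w (p i))) :=
        conj_mul_re_eq _ _
    _ ≤ ‖w (p (i + 2))‖ * ‖w (p i)‖ * -(√2 / 2) :=
        mul_le_mul_of_nonneg_left hcos (by positivity)
    _ ≤ √2 * 2 * -(√2 / 2) := mul_le_mul_of_nonpos_right hmul (by linarith [Real.sqrt_nonneg 2])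
    _ = -2 := by linarith [Real.mul_self_sqrt two_pos.le]

theorem segmentMeetsTriangle_of_triple_le {a b x : R3} (hax : 0 < triple q a x)
    (hxb : 0 < triple q x b) (hab : 0 < triple q a b) (ht : 0 < triple a x b)
    (hle : triple q a x + triple q x b ≤ triple a x b + triple q a b) :
    ∃ u r s, SegmentMeetsTriangle q x a b u r s := by
  set d := triple a x b + triple q a b with hd
  have hd0 : 0 < d := add_pos ht hab
  have hu : 1 - triple q a b / d = triple a x b / d := by
    rw [eq_div_iff hd0.ne', sub_mul, div_mul_cancel₀ _ hd0.ne', hd]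
    ring
  have hcombo : triple a x b • q + triple q a b • x = triple q x b • a + triple q a x • b := by
    rw [triple_smul_eq, triple_swap q a b, neg_smul]
    abel
  refine ⟨triple q a b / d, triple q x b / d, triple q a x / d, div_pos hab hd0,
    (div_lt_one hd0).2 (by linarith), div_pos hxb hd0, div_pos hax hd0, ?_, ?_⟩
  · rw [← add_div, div_le_one hd0]
    linarith
  · rw [hu]
    simp only [div_eq_inv_mul, mul_smul, ← smul_add, hcombo]

/-- The point `p (i + 2)` is close to both neighbours `p (i + 1)` and `p (i + 3)` but behind the
axis, as seen from `p i`; this is incompatible with the Radon partition. -/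
theorem Encircles.not_segmentMeetsTriangle (he : Encircles p q) (hp : IsFrame p) (hq : IsAxis p q)
    {i : Fin 4} {u r s : ℝ} (hmax : ∀ j, ‖p j‖ ≤ ‖p i‖) (hd : dist (p i) q ≤ √8) :
    ¬SegmentMeetsTriangle q (p i) (p (i + 3)) (p (i + 1)) u r s := fun h => by
  obtain ⟨w, hw⟩ := exists_isCylindrical hq.ne_zero
  have hdist1 := hp.dist_le (i + 1)
  have hdist2 := hp.dist_le (i + 2)
  have hdist3 := hp.dist_le (i + 3)
  simp only [add_assoc, Fin.reduceAdd, add_zero] at hdist1 hdist2 hdist3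
  have hqp (j : Fin 4) : 2 ≤ dist q (p j) := dist_comm (p j) q ▸ hq.two_le_dist j
  obtain ⟨hm, hm', hqp_norm⟩ := h.inner_bounds hq.two_le_norm (hp.two_le_norm i) (hp.norm_lt i)
    (hmax _) (hmax _) (dist_comm (p i) q ▸ hd) (hqp _) (hqp _)
    (hp.two_le_dist _ _ (by fin_cases i <;> decide))
    (hp.two_le_dist _ _ (by fin_cases i <;> decide))
  have acute {j : Fin 4} (hj : dist (p j) (p i) ≤ 2.61) : 0 < (conj (w (p j)) * w (p i)).re :=
    hw.conj_mul_re_pos_of_inner_bounds hq.two_le_norm (hp.two_le_norm j) (hp.norm_lt i) hm hm'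
      (hqp j) hj
  have hacute1 : 0 < (conj (w (p i)) * w (p (i + 1))).re := by
    rw [conj_mul_re_eq, cos_turn_comm, mul_comm ‖_‖, ← conj_mul_re_eq]
    exact acute (dist_comm (p i) _ ▸ hp.dist_le i)
  have hbehind := he.conj_mul_re_le_neg_two hp hq hw hacute1 (acute hdist3)
    (hw.four_le_norm_sq_of_inner_bounds hq.two_le_norm (hp.norm_lt i) hm hm')
  have hq4 := h.four_le hq.two_le_norm (hqp _) (hqp _)
  rw [real_inner_self_eq_norm_sq] at hq4
  have hinner : inner ℝ (p (i + 2)) (p i) = inner ℝ (p (i + 2)) q * inner ℝ q (p i) / ‖q‖ ^ 2 +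
      (conj (w (p (i + 2))) * w (p i)).re := by
    rw [hw.inner_eq, height_mul_height, real_inner_comm q]
  have hd8 := le_sq_of_dist_le hd
  rw [Real.sq_sqrt (by norm_num), real_inner_comm] at hd8
  have hq8 := four_le_sq hq.two_le_norm
  have hC := sq_le_of_le_dist two_pos.le (hq.two_le_dist (i + 2))
  exact (lt_of_radial_le_neg_two h.pos h.lt_one (add_pos h.left_pos h.right_pos) hq4 hd8 hq8 hm
    (by linarith [norm_sq_lt_eight (hp.norm_lt i)]) hqp_norm (four_le_sq (hp.two_le_norm _))
    (by linarith) hinner hbehind).not_ge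
    (h.le_of_dist_le (hp.norm_lt (i + 2)) hdist2 (dist_comm (p (i + 1)) _ ▸ hdist1))

theorem Encircles.triple_add_triple_lt_of_nonpos (he : Encircles p q) (hp : IsFrame p)
    (hq : IsAxis p q) {i : Fin 4} (h : triple q (p (i + 3)) (p (i + 1)) ≤ 0) :
    triple (p (i + 3)) (p i) (p (i + 1)) + triple q (p (i + 3)) (p (i + 1)) <
      triple q (p (i + 3)) (p i) + triple q (p i) (p (i + 1)) := by
  have h0 := he.triple_pos i
  have h3 := he.triple_pos (i + 3)
  simp only [add_assoc, Fin.reduceAdd, add_zero] at h3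
  have hswap : 0 ≤ triple q (p (i + 1)) (p (i + 3)) := by
    rw [triple_swap]
    exact neg_nonneg.2 h
  obtain ⟨u, hu, huq⟩ := hp.exists_inner_pos he.inBidualCone
  have ht := triple_pos_of_triple_nonneg (hu (i + 3)) (hu i) (hu (i + 1)) huq h0.le hswap h3
  have hsum := one_lt_sum_of_eq_sum_smul
    (a := ![p (i + 3), p i, p (i + 1)]) (α := ![_ / _, _ / _, _ / _])
    (by simpa [Fin.forall_fin_succ] using
      ⟨div_nonneg h0.le ht.le, div_nonneg hswap ht.le, div_nonneg h3.le ht.le⟩)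
    (by simpa [Fin.sum_univ_succ] using eq_add_smul_of_triple_ne_zero ht.ne' q) hq.two_le_norm
    (by simpa [Fin.forall_fin_succ] using ⟨hp.norm_lt _, hp.norm_lt _, hp.norm_lt _⟩)
    (by simpa [Fin.forall_fin_succ] using
      ⟨hq.two_le_dist _, hq.two_le_dist _, hq.two_le_dist _⟩)
  simp only [Fin.sum_univ_three, Matrix.cons_val] at hsum
  rw [← add_div, ← add_div, one_lt_div ht, triple_swap q (p (i + 3)) (p (i + 1))] at hsum
  linarith

theorem eq_add_smul_of_triple_eq_zero {a b x u : R3} (ha : 0 < inner ℝ u a) (hb : 0 < inner ℝ u b)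
    (hx : 0 < inner ℝ u x) (hax : 0 < triple q a x) (hxb : 0 < triple q x b)
    (h : triple a x b = 0) : 0 < triple q a b ∧
      x = (triple q x b / triple q a b) • a + (triple q a x / triple q a b) • b := by
  have hinner := triple_mul_inner_eq a x b q u
  rw [h, zero_mul, triple_swap q a b] at hinner
  have hab : 0 < triple q a b := by
    refine pos_of_mul_pos_left ?_ hx.le
    linarith [mul_pos hxb ha, mul_pos hax hb]
  have hcombo := triple_smul_eq a x b q
  rw [h, zero_smul, triple_swap q a b, neg_smul] at hcombo
  refine ⟨hab, ?_⟩
  rw [div_eq_inv_mul, div_eq_inv_mul, mul_smul, mul_smul, ← smul_add, eq_inv_smul_iff₀ hab.ne',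
    ← sub_eq_zero, ← neg_eq_zero, hcombo]
  abel

theorem Encircles.eq_add_smul_of_triple_eq_zero (he : Encircles p q) (hp : IsFrame p) {i : Fin 4}
    (h : triple (p (i + 3)) (p i) (p (i + 1)) = 0) : 0 < triple q (p (i + 3)) (p (i + 1)) ∧
      p i = (triple q (p i) (p (i + 1)) / triple q (p (i + 3)) (p (i + 1))) • p (i + 3) +
        (triple q (p (i + 3)) (p i) / triple q (p (i + 3)) (p (i + 1))) • p (i + 1) := by
  obtain ⟨u, hu⟩ := hp.exists_hemisphere
  have h3 := he.triple_pos (i + 3)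
  simp only [add_assoc, Fin.reduceAdd, add_zero] at h3
  exact _root_.eq_add_smul_of_triple_eq_zero (hu _) (hu _) (hu _) h3 (he.triple_pos i) h

theorem Encircles.triple_lt_of_triple_eq_zero (he : Encircles p q) (hp : IsFrame p) {i : Fin 4}
    (h : triple (p (i + 3)) (p i) (p (i + 1)) = 0) : triple q (p (i + 3)) (p (i + 1)) <
      triple q (p (i + 3)) (p i) + triple q (p i) (p (i + 1)) := by
  obtain ⟨hpos, heq⟩ := he.eq_add_smul_of_triple_eq_zero hp h
  have h0 := he.triple_pos i
  have h3 := he.triple_pos (i + 3)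
  simp only [add_assoc, Fin.reduceAdd, add_zero] at h3
  have hsum := one_lt_sum_of_eq_sum_smul (a := ![p (i + 3), p (i + 1)]) (α := ![_ / _, _ / _])
    (by simpa [Fin.forall_fin_succ] using ⟨div_nonneg h0.le hpos.le, div_nonneg h3.le hpos.le⟩)
    (by simpa [Fin.sum_univ_succ] using heq) (hp.two_le_norm i)
    (by simpa [Fin.forall_fin_succ] using ⟨hp.norm_lt _, hp.norm_lt _⟩)
    (by simpa [Fin.forall_fin_succ] using
      ⟨hp.two_le_dist _ _ (by fin_cases i <;> decide),
        hp.two_le_dist _ _ (by fin_cases i <;> decide)⟩)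
  simp only [Fin.sum_univ_two, Matrix.cons_val] at hsum
  rw [← add_div, one_lt_div hpos] at hsum
  linarith

/-- The plane through a vertex of maximal norm and its two neighbours separates `q` from the
origin, if the three points are positively oriented. -/
theorem Encircles.triple_add_triple_lt (he : Encircles p q) (hp : IsFrame p) (hq : IsAxis p q)
    {i : Fin 4} (hmax : ∀ j, ‖p j‖ ≤ ‖p i‖) (hd : dist (p i) q ≤ √8)
    (ht : 0 ≤ triple (p (i + 3)) (p i) (p (i + 1))) :
    triple (p (i + 3)) (p i) (p (i + 1)) + triple q (p (i + 3)) (p (i + 1)) <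
      triple q (p (i + 3)) (p i) + triple q (p i) (p (i + 1)) := by
  rcases ht.eq_or_lt' with ht0 | hpos
  · rw [ht0, zero_add]
    exact he.triple_lt_of_triple_eq_zero hp ht0
  rcases le_or_gt (triple q (p (i + 3)) (p (i + 1))) 0 with hab | hab
  · exact he.triple_add_triple_lt_of_nonpos hp hq hab
  · by_contra! hle
    have h3 := he.triple_pos (i + 3)
    simp only [add_assoc, Fin.reduceAdd, add_zero] at h3
    obtain ⟨u, r, s, h⟩ := segmentMeetsTriangle_of_triple_le h3 (he.triple_pos i) hab hpos hle
    exact he.not_segmentMeetsTriangle hp hq hmax hd h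

end FacePlane

section Replacement

variable {p p' : Fin 4 → R3} {q : R3}

theorem turn_add_turn_eq {a b c : ℂ} (ha : a ≠ 0) (hb : b ≠ 0) (hc : c ≠ 0)
    (hac : 0 < turn a c ∧ turn a c < pi)
    (h : 0 < turn a b ∧ turn a b < pi ∨ 0 < turn b c ∧ turn b c < pi) :
    turn a b + turn b c = turn a c := by
  obtain ⟨m, hm⟩ := Real.Angle.angle_eq_iff_two_pi_dvd_sub.1 (coe_turn_add_turn ha hb hc)
  have bounds (a b : ℂ) : -pi < turn a b ∧ turn a b ≤ pi :=
    ⟨Complex.neg_pi_lt_arg _, Complex.arg_le_pi _⟩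
  have hab := bounds a b
  have hbc := bounds b c
  have hlt : 2 * pi * m < 2 * pi * 1 := by linarith
  have hgt : 2 * pi * (-1) < 2 * pi * m := by
    rcases h with h | h <;> linarith
  have hm0 : m = 0 := by
    have hpi := Real.two_pi_pos
    have h1 : m < 1 := by exact_mod_cast lt_of_mul_lt_mul_left hlt hpi.le
    have h2 : -1 < m := by exact_mod_cast lt_of_mul_lt_mul_left hgt hpi.le
    lia
  rw [hm0, Int.cast_zero, mul_zero] at hm
  exact sub_eq_zero.1 hm

theorem sum_turn_eq_two_pi {n : ℕ} [NeZero n] {a : Fin n → ℂ} (ha : ∀ i, a i ≠ 0)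
    (hpos : 0 < ∑ i, turn (a i) (a (i + 1))) (hlt : ∑ i, turn (a i) (a (i + 1)) < 2 * pi * 2) :
    ∑ i, turn (a i) (a (i + 1)) = 2 * pi := by
  obtain ⟨m, hm⟩ := exists_int_sum_turn ha
  have hpi := Real.two_pi_pos
  rw [hm] at hpos hlt
  have h1 : m < 2 := by exact_mod_cast lt_of_mul_lt_mul_left hlt hpi.le
  have h2 : 0 < m := by exact_mod_cast pos_of_mul_pos_right hpos hpi.le
  obtain rfl : m = 1 := by lia
  rw [hm, Int.cast_one, mul_one]

theorem triple_pos_of_triple_neg {a b x u : R3} (ha : 0 < inner ℝ u a) (hb : 0 < inner ℝ u b)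
    (hx : 0 < inner ℝ u x) (hq : 0 ≤ inner ℝ u q) (ht : triple a x b < 0)
    (hax : 0 < triple q a x) (hxb : 0 < triple q x b) : 0 < triple q a b := by
  have hinner := triple_mul_inner_eq a x b q u
  rw [triple_swap q a b] at hinner
  refine pos_of_mul_pos_left ?_ hx.le
  linarith [mul_pos hxb ha, mul_pos hax hb, mul_nonpos_of_nonpos_of_nonneg ht.le hq]

theorem triple_pos_or_triple_pos {a b x u : R3} (ha : 0 < inner ℝ u a) (hb : 0 < inner ℝ u b)
    (hx : 0 < inner ℝ u x) (hq : 0 ≤ inner ℝ u q) (ht : 0 ≤ triple a x b)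
    (hab : 0 < triple q a b) : 0 < triple q a x ∨ 0 < triple q x b := by
  have hinner := triple_mul_inner_eq a x b q u
  rw [triple_swap q a b] at hinner
  by_contra! hcon
  linarith [mul_nonpos_of_nonpos_of_nonneg hcon.1 hb.le,
    mul_nonpos_of_nonpos_of_nonneg hcon.2 ha.le, mul_nonneg ht hq, mul_pos hab hx]

theorem InBidualCone.of_eq_add_smul {α β γ : ℝ} {i j m : Fin 4} (hα : 0 ≤ α) (hβ : 0 ≤ β)
    (hγ : 0 ≤ γ) (h : q = α • p i + (β • p j + γ • p m)) : InBidualCone p q := fun v hv => by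
  rw [h, inner_add_right, inner_add_right, real_inner_smul_right, real_inner_smul_right,
    real_inner_smul_right]
  have hi := hv i
  have hj := hv j
  have hm := hv m
  positivity

theorem Encircles.triple_pos_opposite (he : Encircles p q) (hp : IsFrame p) {i : Fin 4}
    (ht : triple (p (i + 3)) (p i) (p (i + 1)) < 0) : 0 < triple q (p (i + 3)) (p (i + 1)) := by
  obtain ⟨u, hu, huq⟩ := hp.exists_inner_pos he.inBidualCone
  have h3 := he.triple_pos (i + 3)
  simp only [add_assoc, Fin.reduceAdd, add_zero] at h3
  exact triple_pos_of_triple_neg (hu _) (hu _) (hu _) huq ht h3 (he.triple_pos i)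

theorem Encircles.triple_pos_of_triple_opposite_pos (he : Encircles p q) (hp : IsFrame p)
    {i : Fin 4} (ht : 0 < triple q (p (i + 3)) (p (i + 1))) :
    0 < triple (p (i + 3)) (p (i + 1)) (p (i + 2)) := by
  obtain ⟨u, hu, huq⟩ := hp.exists_inner_pos he.inBidualCone
  have h1 := he.triple_pos (i + 1)
  have h2 := he.triple_pos (i + 2)
  simp only [add_assoc, Fin.reduceAdd] at h1 h2
  exact triple_pos_of_triple_nonneg (hu _) (hu _) (hu _) huq h1.le h2.le ht

theorem Encircles.of_triple_opposite_pos (hp : IsFrame p) (hq : IsAxis p q)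
    (hd : InBidualCone p q) {i : Fin 4} (h1 : 0 < triple q (p (i + 1)) (p (i + 2)))
    (h2 : 0 < triple q (p (i + 2)) (p (i + 3))) (h3 : 0 < triple q (p (i + 3)) (p (i + 1)))
    (ht : 0 ≤ triple (p (i + 3)) (p i) (p (i + 1))) : Encircles p q := by
  obtain ⟨w, hw⟩ := exists_isCylindrical hq.ne_zero
  obtain ⟨u, hu, huq⟩ := hp.exists_inner_pos hd
  have hor := triple_pos_or_triple_pos (hu (i + 3)) (hu (i + 1)) (hu i) huq ht h3
  have turn_mem {a b : R3} (h : 0 < triple q a b) : 0 < turn (w a) (w b) ∧ turn (w a) (w b) < pi :=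
    turn_pos_and_lt_pi_iff.2 ((hw.triple_pos_iff hq.ne_zero).1 h)
  have left_ne {a b : R3} (h : 0 < triple q a b) : w a ≠ 0 := fun h0 => by
    simp [hw.triple_eq, h0] at h
  have right_ne {a b : R3} (h : 0 < triple q a b) : w b ≠ 0 := fun h0 => by
    simp [hw.triple_eq, h0] at h
  have hne : ∀ j, w (p j) ≠ 0 :=
    forall_fin_four i (hor.elim right_ne left_ne) (left_ne h1) (left_ne h2) (left_ne h3)
  have hadd := turn_add_turn_eq (hne (i + 3)) (hne i) (hne (i + 1)) (turn_mem h3)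
    (hor.imp turn_mem turn_mem)
  have hturn1 := turn_mem h1
  have hturn2 := turn_mem h2
  have hturn3 := turn_mem h3
  have hsum := sum_fin_four (fun j => turn (w (p j)) (w (p (j + 1)))) i
  simp only [add_assoc, Fin.reduceAdd, add_zero] at hsum
  have hlt : ∀ j, turn (w (p j)) (w (p (j + 1))) < pi := by
    refine forall_fin_four i ?_ ?_ ?_ ?_
    · exact hor.elim (fun h => by linarith [(turn_mem h).1]) fun h => (turn_mem h).2
    all_goals simp only [add_assoc, Fin.reduceAdd, add_zero]
    · exact hturn1.2
    · exact hturn2.2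
    · exact hor.elim (fun h => (turn_mem h).2) fun h => by linarith [(turn_mem h).1]
  exact .of_sum_turn hp hq hd hw hne hlt (sum_turn_eq_two_pi hne (by linarith) (by linarith))

/-- The axis lies in the cone of the three fixed vertices, so the fourth one can be put anywhere on
the other side of the plane through the origin and its neighbours. -/
theorem Encircles.of_eq_of_ne (he : Encircles p q) (hp : IsFrame p) (hp' : IsFrame p')
    (hq' : IsAxis p' q) {i : Fin 4} (hi : ∀ j, j ≠ i → p' j = p j)
    (ht : 0 < triple q (p (i + 3)) (p (i + 1)))
    (ht' : 0 ≤ triple (p' (i + 3)) (p' i) (p' (i + 1))) : Encircles p' q := by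
  have hi1 : p' (i + 1) = p (i + 1) := hi _ (by simp)
  have hi2 : p' (i + 2) = p (i + 2) := hi _ (by simp)
  have hi3 : p' (i + 3) = p (i + 3) := hi _ (by simp)
  have h1 := he.triple_pos (i + 1)
  have h2 := he.triple_pos (i + 2)
  simp only [add_assoc, Fin.reduceAdd] at h1 h2
  obtain ⟨u, hu, huq⟩ := hp.exists_inner_pos he.inBidualCone
  obtain ⟨α, β, γ, hα, hβ, hγ, h⟩ := eq_add_smul_of_triple_nonneg (hu (i + 3)) (hu (i + 1))
    (hu (i + 2)) huq h1.le h2.le ht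
  rw [← hi1, ← hi2] at h1
  rw [← hi2, ← hi3] at h2
  rw [← hi3, ← hi1] at ht
  rw [← hi1, ← hi2, ← hi3] at h
  exact .of_triple_opposite_pos hp' hq' (.of_eq_add_smul hα hβ hγ.le h) h1 h2 ht ht'

end Replacement

section Reflection

variable {E : Type*} [NormedAddCommGroup E] [InnerProductSpace ℝ E] {n v : E}

theorem inner_reflection_orthogonal_singleton (n x : E) :
    inner ℝ n ((ℝ ∙ n)ᗮ.reflection x) = -inner ℝ n x := by
  rw [← LinearIsometryEquiv.inner_map_map (ℝ ∙ n)ᗮ.reflection n, Submodule.reflection_reflection,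
    Submodule.reflection_orthogonalComplement_singleton_eq_neg, inner_neg_left]

theorem dist_reflection_of_inner_eq_zero (x : E) (h : inner ℝ n v = 0) :
    dist ((ℝ ∙ n)ᗮ.reflection x) v = dist x v := by
  nth_rewrite 1 [← (ℝ ∙ n)ᗮ.reflection_mem_subspace_eq_self
    (Submodule.mem_orthogonal_singleton_iff_inner_right.2 h)]
  exact LinearIsometryEquiv.dist_map _ _ _

theorem dist_le_dist_reflection {x : E} (hx : 0 ≤ inner ℝ n x) (hv : 0 ≤ inner ℝ n v) :
    dist x v ≤ dist ((ℝ ∙ n)ᗮ.reflection x) v := by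
  refine le_of_sq_le_sq ?_ dist_nonneg
  rw [dist_sq_eq, dist_sq_eq, LinearIsometryEquiv.norm_map, Submodule.reflection_orthogonal_apply,
    Submodule.reflection_singleton_apply]
  simp only [inner_neg_left, inner_sub_left, real_inner_smul_left, two_smul, inner_add_left,
    RCLike.ofReal_real_eq_id, id_eq]
  have hnonneg : 0 ≤ inner ℝ n x / ‖n‖ ^ 2 * inner ℝ n v := by positivity
  linarith

end Reflection

section Links

theorem zero_mem_segment_iff_turn_eq_pi {a b : ℂ} (ha : a ≠ 0) (hb : b ≠ 0) :
    0 ∈ segment ℝ a b ↔ turn a b = pi := by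
  have hturn : turn a b = pi ↔ (turn a b : Real.Angle) = (pi : ℝ) := by
    rw [turn, Complex.arg_coe_angle_eq_iff_eq_toReal, Real.Angle.toReal_pi]
  rw [mem_segment_iff_sameRay, zero_sub, sub_zero, Complex.sameRay_iff,
    or_iff_right (neg_ne_zero.2 ha), or_iff_right hb, ← Complex.arg_coe_angle_eq_iff,
    Complex.arg_neg_coe_angle ha, hturn, coe_turn ha hb, sub_eq_iff_eq_add', eq_comm]

theorem exists_smul_mem_convexHull {E : Type*} [AddCommGroup E] [Module ℝ E] {s : Set E}
    {x y z q : E} {α β γ : ℝ} (hx : x ∈ s) (hy : y ∈ s) (hz : z ∈ s) (hα : 0 ≤ α) (hβ : 0 ≤ β)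
    (hγ : 0 < γ) (h : q = α • x + (β • y + γ • z)) :
    ∃ t : ℝ, 0 < t ∧ t • q ∈ convexHull ℝ s := by
  refine ⟨(∑ i, ![α, β, γ] i)⁻¹, ?_, ?_⟩
  · rw [Fin.sum_univ_three]
    exact inv_pos.2 (add_pos_of_nonneg_of_pos (add_nonneg hα hβ) hγ)
  have hq : q = ∑ i, ![α, β, γ] i • ![x, y, z] i := by
    rw [h, Fin.sum_univ_three, add_assoc]
    rfl
  rw [hq]
  refine Finset.univ.centerMass_mem_convexHull ?_ ?_ ?_
  · simpa [Fin.forall_fin_succ] using ⟨hα, hβ, hγ.le⟩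
  · rw [Fin.sum_univ_three]
    exact add_pos_of_nonneg_of_pos (add_nonneg hα hβ) hγ
  · simpa [Fin.forall_fin_succ] using ⟨hx, hy, hz⟩

variable {q : R3} {w : R3 →ₗ[ℝ] ℂ}

theorem IsCylindrical.signedDihedralAngle_eq (hw : IsCylindrical q w) (hq : q ≠ 0) (a b : R3) :
    signedDihedralAngle q a b = turn (w a) (w b) := by
  have hnorm : 0 < ‖q‖ := norm_pos_iff.2 hq
  rw [turn, ← Complex.arg_real_mul (conj (w a) * w b) (pow_pos hnorm 2)]
  refine congrArg Complex.arg (Complex.ext ?_ ?_)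
  · rw [Complex.re_ofReal_mul, hw.inner_eq, height, height]
    field
  · rw [Complex.im_ofReal_mul]
    change ‖q‖ * triple q a b = _
    rw [hw.triple_eq, sq, mul_assoc]

theorem IsCylindrical.neg (hw : IsCylindrical q w) :
    IsCylindrical (-q) (Complex.conjAe.toLinearMap ∘ₗ w) where
  inner_eq a b := by
    have hre : (conj (conj (w a)) * conj (w b)).re = (conj (w a) * w b).re := by
      rw [← map_mul, Complex.conj_re]
    rw [hw.inner_eq]
    simp only [height, inner_neg_left, norm_neg, neg_div, neg_mul_neg]
    exact congrArg _ hre.symm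
  triple_eq a b := by
    have him : (conj (conj (w a)) * conj (w b)).im = -(conj (w a) * w b).im := by
      rw [← map_mul, Complex.conj_im]
    rw [← neg_one_smul ℝ q, triple_smul_left, hw.triple_eq, norm_smul, norm_neg, norm_one, one_mul,
      neg_one_mul, ← mul_neg]
    exact congrArg _ him.symm

theorem IsCylindrical.map_eq_zero_iff (hw : IsCylindrical q w) {x : R3} :
    w x = 0 ↔ x ∈ Submodule.span ℝ {q} := by
  constructor
  · intro hx
    refine Submodule.mem_span_singleton.2 ⟨height q x / ‖q‖, ?_⟩
    have hheight : height q ((height q x / ‖q‖) • q - x) = 0 := by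
      rw [height, inner_sub_right, real_inner_smul_right, real_inner_self_eq_norm_sq, height]
      rcases eq_or_ne ‖q‖ 0 with h0 | h0
      · rw [h0, div_zero]
      · field
    have hnorm := hw.norm_sq ((height q x / ‖q‖) • q - x)
    rw [map_sub, map_smul, hw.map_eq_zero, hx, hheight, smul_zero, sub_zero, norm_zero] at hnorm
    exact sub_eq_zero.1 (norm_eq_zero.1 (pow_eq_zero_iff two_ne_zero |>.1 (by linarith)))
  · rw [Submodule.mem_span_singleton]
    rintro ⟨t, rfl⟩
    rw [map_smul, hw.map_eq_zero, smul_zero]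

theorem IsCylindrical.zero_mem_segment_iff (hw : IsCylindrical q w) {a b : R3} :
    0 ∈ segment ℝ (w a) (w b) ↔ ∃ x ∈ segment ℝ a b, x ∈ Submodule.span ℝ {q} := by
  have himage := image_segment ℝ w.toAffineMap a b
  rw [LinearMap.coe_toAffineMap] at himage
  rw [← himage]
  exact exists_congr fun x => and_congr_right fun _ => hw.map_eq_zero_iff

theorem IsCylindrical.lineLinks_iff (hw : IsCylindrical q w) {n : ℕ} [NeZero n]
    {p : Fin n → R3} :
    LineLinks q p ↔ q ≠ 0 ∧ (∀ i, (0 : ℂ) ∉ segment ℝ (w (p i)) (w (p (i + 1)))) ∧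
      ∑ i, turn (w (p i)) (w (p (i + 1))) ≠ 0 := by
  refine and_congr_right fun hq => and_congr ?_ ?_
  · simp only [hw.zero_mem_segment_iff, not_exists, not_and]
  · simp only [linkingNumber, hw.signedDihedralAngle_eq hq, ne_eq, div_eq_zero_iff,
      Real.two_pi_pos.ne', or_false]

theorem sum_turn_eq_two_pi_or_eq_neg {a : Fin 4 → ℂ} (ha : ∀ i, a i ≠ 0)
    (hlt : ∀ i, turn (a i) (a (i + 1)) < pi) (hsum : ∑ i, turn (a i) (a (i + 1)) ≠ 0) :
    ∑ i, turn (a i) (a (i + 1)) = 2 * pi ∨ ∑ i, turn (a i) (a (i + 1)) = -(2 * pi) := by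
  have hpi := Real.two_pi_pos
  obtain ⟨m, hm⟩ := exists_int_sum_turn ha
  have hbound : 2 * pi * |(m : ℝ)| < 2 * pi * 2 := calc
    2 * pi * |(m : ℝ)| = |∑ i, turn (a i) (a (i + 1))| := by rw [hm, abs_mul, abs_of_pos hpi]
    _ ≤ ∑ i, |turn (a i) (a (i + 1))| := Finset.abs_sum_le_sum_abs _ _
    _ < ∑ _ : Fin 4, pi := Finset.sum_lt_sum_of_nonempty Finset.univ_nonempty fun i _ =>
      abs_lt.2 ⟨Complex.neg_pi_lt_arg _, hlt i⟩
    _ = 2 * pi * 2 := by rw [Fin.sum_const, nsmul_eq_mul]; push_cast; ring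
  have habs : |m| < 2 := by exact_mod_cast lt_of_mul_lt_mul_left hbound hpi.le
  have hne : m ≠ 0 := by
    rintro rfl
    exact hsum (by rw [hm, Int.cast_zero, mul_zero])
  have hone : m = 1 ∨ m = -1 := by
    rw [abs_lt] at habs
    lia
  rcases hone with rfl | rfl
  · exact .inl (by rw [hm, Int.cast_one, mul_one])
  · exact .inr (by rw [hm, Int.cast_neg, Int.cast_one, mul_neg_one])

variable {p : Fin 4 → R3}

theorem HalfLineLinks.encircles (h : HalfLineLinks q p) (hp : IsFrame p)
    (hq : IsAxis p q) : Encircles p q ∨ Encircles (-p) (-q) := by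
  obtain ⟨hline, t, ht, hmem⟩ := h
  have hd := InBidualCone.of_smul_mem_convexHull ht hmem
  obtain ⟨w, hw⟩ := exists_isCylindrical hq.ne_zero
  obtain ⟨-, hseg, hsum⟩ := hw.lineLinks_iff.1 hline
  have hne (i : Fin 4) : w (p i) ≠ 0 := fun h0 => hseg i (h0 ▸ left_mem_segment ℝ _ _)
  have hturn (i : Fin 4) : turn (w (p i)) (w (p (i + 1))) ≠ pi :=
    mt (zero_mem_segment_iff_turn_eq_pi (hne i) (hne (i + 1))).2 (hseg i)
  have hlt (i : Fin 4) : turn (w (p i)) (w (p (i + 1))) < pi :=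
    (Complex.arg_le_pi _).lt_of_ne (hturn i)
  rcases sum_turn_eq_two_pi_or_eq_neg hne hlt hsum with hsum | hsum
  · exact .inl (.of_sum_turn hp hq hd hw hne hlt hsum)
  have hneg (i : Fin 4) : turn ((Complex.conjAe.toLinearMap ∘ₗ w) ((-p) i))
      ((Complex.conjAe.toLinearMap ∘ₗ w) ((-p) (i + 1))) = -turn (w (p i)) (w (p (i + 1))) := by
    rw [← turn_conj_conj (hturn i)]
    simp [turn]
  refine .inr (.of_sum_turn hp.neg hq.neg hd.neg hw.neg (fun i => ?_) (fun i => ?_) ?_)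
  · simpa using hne i
  · rw [hneg]
    exact neg_lt.1 (Complex.neg_pi_lt_arg _)
  · rw [Finset.sum_congr rfl fun i _ => hneg i, Finset.sum_neg_distrib, hsum, neg_neg]

theorem Encircles.eq_add_smul_of_triple_nonpos (he : Encircles p q) (hp : IsFrame p) {i : Fin 4}
    (ht : triple q (p (i + 3)) (p (i + 1)) ≤ 0) :
    0 < triple (p (i + 3)) (p i) (p (i + 1)) ∧
      ∃ α β γ : ℝ, 0 ≤ α ∧ 0 ≤ β ∧ 0 < γ ∧ q = α • p (i + 3) + (β • p i + γ • p (i + 1)) := by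
  obtain ⟨u, hu, huq⟩ := hp.exists_inner_pos he.inBidualCone
  have h0 := he.triple_pos i
  have h3 := he.triple_pos (i + 3)
  simp only [add_assoc, Fin.reduceAdd, add_zero] at h3
  rw [triple_swap, neg_nonpos] at ht
  exact ⟨triple_pos_of_triple_nonneg (hu _) (hu _) (hu _) huq h0.le ht h3,
    eq_add_smul_of_triple_nonneg (hu _) (hu _) (hu _) huq h0.le ht h3⟩

theorem Encircles.exists_smul_mem_convexHull (he : Encircles p q) (hp : IsFrame p) :
    ∃ t : ℝ, 0 < t ∧ t • q ∈ convexHull ℝ (Set.range p) := by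
  rcases le_or_gt (triple q (p (0 + 3)) (p (0 + 1))) 0 with ht | ht
  · obtain ⟨-, α, β, γ, hα, hβ, hγ, h⟩ := he.eq_add_smul_of_triple_nonpos hp ht
    exact _root_.exists_smul_mem_convexHull ⟨_, rfl⟩ ⟨_, rfl⟩ ⟨_, rfl⟩ hα hβ hγ h
  · obtain ⟨u, hu, huq⟩ := hp.exists_inner_pos he.inBidualCone
    obtain ⟨α, β, γ, hα, hβ, hγ, h⟩ := eq_add_smul_of_triple_nonneg (hu 3) (hu 1) (hu 2) huq
      (he.triple_pos 1).le (he.triple_pos 2).le ht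
    exact _root_.exists_smul_mem_convexHull ⟨_, rfl⟩ ⟨_, rfl⟩ ⟨_, rfl⟩ hα hβ hγ h

theorem Encircles.halfLineLinks (he : Encircles p q) (hp : IsFrame p) (hq : IsAxis p q) :
    HalfLineLinks q p := by
  obtain ⟨w, hw⟩ := exists_isCylindrical hq.ne_zero
  have hne (i : Fin 4) : w (p i) ≠ 0 := ne_zero_of_two_le_norm_sq (he.two_le_norm_sq hp hq hw i)
  refine ⟨hw.lineLinks_iff.2 ⟨hq.ne_zero, fun i => ?_, ?_⟩, he.exists_smul_mem_convexHull hp⟩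
  · rw [zero_mem_segment_iff_turn_eq_pi (hne i) (hne (i + 1))]
    exact (turn_pos_and_lt_pi_iff.2 ((hw.triple_pos_iff hq.ne_zero).1 (he.triple_pos i))).2.ne
  · rw [he.sum_turn hp hq hw]
    exact Real.two_pi_pos.ne'

theorem Encircles.triple_pos_or_triple_pos (he : Encircles p q) (hp : IsFrame p) (i : Fin 4) :
    0 < triple (p (i + 3)) (p i) (p (i + 1)) ∨
      0 < triple (p (i + 1)) (p (i + 2)) (p (i + 3)) := by
  rcases le_or_gt (triple q (p (i + 3)) (p (i + 1))) 0 with ht | ht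
  · exact .inl (he.eq_add_smul_of_triple_nonpos hp ht).1
  · exact .inr (triple_rotate (p (i + 3)) _ _ ▸ he.triple_pos_of_triple_opposite_pos hp ht)

theorem Encircles.triple_nonneg_of_triple_neg (he : Encircles p q) (hp : IsFrame p) {i : Fin 4}
    (ht : triple (p (i + 3)) (p i) (p (i + 1)) < 0) :
    0 ≤ triple (p i) (p (i + 1)) (p (i + 2)) := by
  by_contra! hcon
  have hopp := he.triple_pos_opposite hp (i := i + 1)
  have hpos := he.triple_pos_of_triple_opposite_pos hp (i := i + 1)
  have h3 := he.triple_pos (i + 3)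
  simp only [add_assoc, Fin.reduceAdd, add_zero] at hopp hpos h3
  have h02 := hopp hcon
  have hplucker : triple (p i) (p (i + 1)) (p (i + 2)) * triple q (p (i + 3)) (p i) =
      triple (p i) (p (i + 2)) (p (i + 3)) * triple q (p i) (p (i + 1)) -
        triple (p (i + 3)) (p i) (p (i + 1)) * triple q (p i) (p (i + 2)) := by
    simp only [triple_eq_coords]
    ring
  linarith [mul_pos (hpos h02) (he.triple_pos i), mul_neg_of_neg_of_pos ht h02,
    mul_neg_of_neg_of_pos hcon h3]

theorem Encircles.not_encircles_neg {q' : R3} (he : Encircles p q) (hp : IsFrame p) :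
    ¬Encircles (-p) q' := fun he' => by
  have h0 := he'.triple_pos_or_triple_pos hp.neg 0
  have h1 := he'.triple_pos_or_triple_pos hp.neg 1
  simp only [Pi.neg_apply, triple_neg_neg_neg, Left.neg_pos_iff] at h0 h1
  have hadj (i : Fin 4) := he.triple_nonneg_of_triple_neg hp (i := i)
  rcases h0 with h0 | h0 <;> rcases h1 with h1 | h1
  · exact (hadj 0 h0).not_gt h1
  · exact (hadj 3 h1).not_gt h0
  · exact (hadj 1 h1).not_gt h0
  · exact (hadj 2 h0).not_gt h1

end Links

theorem forall_update_add_one {α : Type*} {P : Fin 4 → α → α → Prop} {p : Fin 4 → α} {i : Fin 4}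
    {x : α} (h : ∀ j, P j (p j) (p (j + 1))) (hnext : P i x (p (i + 1)))
    (hprev : P (i + 3) (p (i + 3)) x) (j : Fin 4) :
    P j (Function.update p i x j) (Function.update p i x (j + 1)) := by
  revert j
  have h1 := h (i + 1)
  have h2 := h (i + 2)
  simp only [add_assoc, Fin.reduceAdd] at h1 h2
  refine forall_fin_four i ?_ ?_ ?_ ?_ <;>
    simpa only [add_assoc, Fin.reduceAdd, add_zero, Function.update_self, ne_eq, left_eq_add,
      add_eq_left, Fin.reduceEq, not_false_eq_true, Function.update_of_ne]

/-- The bounds on the constants of the problem and, for fixed points `q j`, on their norms. -/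
structure Bounds {ι : Type*} (l k h : Fin 4 → ℝ) (q : ι → R3) : Prop where
  l_lt : ∀ i, l i < √8
  k_le : ∀ i, k i ≤ 2.61
  two_le_h : ∀ i, 2 ≤ h i
  h_le : ∀ i, h i ≤ √8
  two_le_norm : ∀ j, 2 ≤ ‖q j‖
  norm_le : ∀ j, ‖q j‖ ≤ √8

/-- The constraints on the distances from the vertices `p i` to one another, to the origin and to
the points `q j`. -/
structure MetricConfig {ι : Type*} (l k h : Fin 4 → ℝ) (q : ι → R3) (p : Fin 4 → R3) : Prop where
  two_le_norm : ∀ i, 2 ≤ ‖p i‖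
  norm_le : ∀ i, ‖p i‖ ≤ l i
  two_le_dist : ∀ i j, i ≠ j → 2 ≤ dist (p i) (p j)
  dist_le : ∀ i, dist (p i) (p (i + 1)) ≤ k i
  le_dist : ∀ i j, h i ≤ dist (p i) (q j)

/-- The quadrilaterals that satisfy the metric constraints and wind counterclockwise around each of
the half-lines from `0` through `q j`. -/
structure Admissible {ι : Type*} (l k h : Fin 4 → ℝ) (q : ι → R3) (p : Fin 4 → R3) : Prop
    extends MetricConfig l k h q p where
  encircles : ∀ j, Encircles p (q j)

section Admissible

variable {ι : Type*} {l k h : Fin 4 → ℝ} {q : ι → R3} {p : Fin 4 → R3} {i : Fin 4} {x : R3}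

theorem MetricConfig.isFrame (hc : MetricConfig l k h q p) (hb : Bounds l k h q) : IsFrame p where
  two_le_norm := hc.two_le_norm
  norm_lt i := (hc.norm_le i).trans_lt (hb.l_lt i)
  two_le_dist := hc.two_le_dist
  dist_le i := (hc.dist_le i).trans (hb.k_le i)

theorem MetricConfig.isAxis (hc : MetricConfig l k h q p) (hb : Bounds l k h q) (j : ι) :
    IsAxis p (q j) where
  two_le_norm := hb.two_le_norm j
  norm_le := hb.norm_le j
  two_le_dist i := (hb.two_le_h i).trans (hc.le_dist i j)

theorem MetricConfig.update (hc : MetricConfig l k h q p) (two_le_norm : 2 ≤ ‖x‖)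
    (norm_le : ‖x‖ ≤ l i) (two_le_dist : ∀ j, j ≠ i → 2 ≤ dist x (p j))
    (dist_next_le : dist x (p (i + 1)) ≤ k i) (dist_prev_le : dist x (p (i + 3)) ≤ k (i + 3))
    (le_dist : ∀ j, h i ≤ dist x (q j)) : MetricConfig l k h q (Function.update p i x) where
  two_le_norm := (Function.forall_update_iff p fun _ y => 2 ≤ ‖y‖).2
    ⟨two_le_norm, fun j _ => hc.two_le_norm j⟩
  norm_le := (Function.forall_update_iff p fun j y => ‖y‖ ≤ l j).2
    ⟨norm_le, fun j _ => hc.norm_le j⟩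
  two_le_dist := by
    refine (Function.forall_update_iff p fun a y => ∀ b, a ≠ b →
      2 ≤ dist y (Function.update p i x b)).2 ⟨fun b hb => ?_, fun a ha => ?_⟩
    · rw [Function.update_of_ne hb.symm]
      exact two_le_dist b hb.symm
    · refine (Function.forall_update_iff p fun b z => a ≠ b → 2 ≤ dist (p a) z).2
        ⟨fun _ => ?_, fun b _ => hc.two_le_dist a b⟩
      rw [dist_comm]
      exact two_le_dist a ha
  dist_le := forall_update_add_one (P := fun j y z => dist y z ≤ k j) hc.dist_le dist_next_le
    (dist_comm x _ ▸ dist_prev_le)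
  le_dist := (Function.forall_update_iff p fun a y => ∀ j, h a ≤ dist y (q j)).2
    ⟨le_dist, fun a _ => hc.le_dist a⟩

theorem Encircles.of_triple_pos {q u : R3} (hu : ∀ i, 0 < inner ℝ u (p i))
    (huq : 0 ≤ inner ℝ u q) (h : ∀ i, 0 < triple q (p i) (p (i + 1))) : Encircles p q := by
  refine ⟨h, ?_⟩
  rcases le_total 0 (triple q (p 2) (p 0)) with h20 | h20
  · obtain ⟨α, β, γ, hα, hβ, hγ, hq⟩ :=
      eq_add_smul_of_triple_nonneg (hu 0) (hu 1) (hu 2) huq (h 1).le h20 (h 0)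
    exact .of_eq_add_smul hα hβ hγ.le hq
  · have h02 : 0 ≤ triple q (p 0) (p 2) := triple_swap q (p 2) (p 0) ▸ neg_nonneg.2 h20
    obtain ⟨α, β, γ, hα, hβ, hγ, hq⟩ :=
      eq_add_smul_of_triple_nonneg (hu 2) (hu 3) (hu 0) huq (h 3).le h02 (h 2)
    exact .of_eq_add_smul hα hβ hγ.le hq

theorem continuous_triple_apply (q : R3) (a b : Fin 4) :
    Continuous fun p : Fin 4 → R3 => triple q (p a) (p b) := by
  unfold triple
  fun_prop

theorem Encircles.eventually {q : R3} (he : Encircles p q) (hp : IsFrame p) :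
    ∀ᶠ p' in 𝓝 p, Encircles p' q := by
  obtain ⟨u, hu, huq⟩ := hp.exists_inner_pos he.inBidualCone
  have inner_pos : ∀ᶠ p' in 𝓝 p, ∀ i, 0 < inner ℝ u (p' i) :=
    Filter.eventually_all.2 fun i => Filter.Tendsto.eventually_const_lt (hu i)
      (Continuous.tendsto (by fun_prop) p)
  have triple_pos : ∀ᶠ p' in 𝓝 p, ∀ i, 0 < triple q (p' i) (p' (i + 1)) :=
    Filter.eventually_all.2 fun i => Filter.Tendsto.eventually_const_lt (he.triple_pos i)
      ((continuous_triple_apply q i (i + 1)).tendsto p)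
  filter_upwards [inner_pos, triple_pos] with p' hu' ht'
  exact .of_triple_pos hu' huq ht'

theorem Admissible.eventually_update [Finite ι] [Nonempty ι] (ha : Admissible l k h q p)
    (hb : Bounds l k h q) {F : Filter ℝ} {γ : ℝ → R3} (hγ : Filter.Tendsto γ F (𝓝 (p i)))
    (two_le_norm : ∀ᶠ s in F, 2 ≤ ‖γ s‖) (norm_le : ∀ᶠ s in F, ‖γ s‖ ≤ l i)
    (two_le_dist_next : ∀ᶠ s in F, 2 ≤ dist (γ s) (p (i + 1)))
    (dist_next_le : ∀ᶠ s in F, dist (γ s) (p (i + 1)) ≤ k i)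
    (two_le_dist_prev : ∀ᶠ s in F, 2 ≤ dist (γ s) (p (i + 3)))
    (dist_prev_le : ∀ᶠ s in F, dist (γ s) (p (i + 3)) ≤ k (i + 3))
    (le_dist : ∀ j, ∀ᶠ s in F, h i ≤ dist (γ s) (q j)) :
    ∀ᶠ s in F, Admissible l k h q (Function.update p i (γ s)) := by
  have hp := ha.isFrame hb
  have hupdate : Filter.Tendsto (fun s => Function.update p i (γ s)) F (𝓝 p) := by
    simpa using (tendsto_const_nhds (x := p)).update i hγ
  have hencircles : ∀ᶠ s in F, ∀ j, Encircles (Function.update p i (γ s)) (q j) :=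
    Filter.eventually_all.2 fun j => hupdate.eventually ((ha.encircles j).eventually hp)
  have two_le_dist_opposite : ∀ᶠ s in F, 2 ≤ dist (γ s) (p (i + 2)) := by
    obtain ⟨j⟩ := ‹Nonempty ι›
    exact ((hγ.dist tendsto_const_nhds).eventually_const_lt
      ((ha.encircles j).two_lt_dist hp (ha.isAxis hb j) i)).mono fun s hs => hs.le
  filter_upwards [two_le_norm, norm_le, two_le_dist_next, dist_next_le, two_le_dist_prev,
    dist_prev_le, Filter.eventually_all.2 le_dist, two_le_dist_opposite, hencircles] with
    s two_le_norm norm_le dist1 dist_next_le dist3 dist_prev_le le_dist dist2 hencircles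
  exact ⟨ha.update two_le_norm norm_le (forall_fin_four i (fun hi => absurd rfl hi)
    (fun _ => dist1) (fun _ => dist2) (fun _ => dist3)) dist_next_le dist_prev_le le_dist,
    hencircles⟩

/-- The winding condition is open, but within the bounds it is equivalent to a closed one. -/
theorem admissible_iff (hb : Bounds l k h q) : Admissible l k h q p ↔
    MetricConfig l k h q p ∧ ∀ j, InBidualCone p (q j) ∧
      ∀ i, 0 ≤ triple (q j) (p i) (p (i + 1)) ∧ 2 ≤ ‖p i‖ ^ 2 - height (q j) (p i) ^ 2 := by
  refine ⟨fun ha => ⟨ha.toMetricConfig, fun j => ⟨(ha.encircles j).inBidualCone, fun i =>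
    ⟨((ha.encircles j).triple_pos i).le, ?_⟩⟩⟩, fun ⟨hc, hj⟩ => ⟨hc, fun j => ?_⟩⟩
  · have hq := ha.isAxis hb j
    obtain ⟨w, hw⟩ := exists_isCylindrical hq.ne_zero
    have := (ha.encircles j).two_le_norm_sq (ha.isFrame hb) hq hw i
    linarith [hw.norm_sq (p i)]
  · have hq := hc.isAxis hb j
    obtain ⟨w, hw⟩ := exists_isCylindrical hq.ne_zero
    exact .of_triple_nonneg (hc.isFrame hb) hq (hj j).1 hw
      (fun i => by linarith [hw.norm_sq (p i), ((hj j).2 i).2]) fun i => ((hj j).2 i).1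

theorem isClosed_setOf_metricConfig : IsClosed {p | MetricConfig l k h q p} := by
  have : {p | MetricConfig l k h q p} = {p | (∀ i, 2 ≤ ‖p i‖) ∧ (∀ i, ‖p i‖ ≤ l i) ∧
      (∀ i j, i ≠ j → 2 ≤ dist (p i) (p j)) ∧ (∀ i, dist (p i) (p (i + 1)) ≤ k i) ∧
      ∀ i j, h i ≤ dist (p i) (q j)} :=
    Set.ext fun p => ⟨fun h => ⟨h.1, h.2, h.3, h.4, h.5⟩,
      fun h => ⟨h.1, h.2.1, h.2.2.1, h.2.2.2.1, h.2.2.2.2⟩⟩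
  rw [this]
  simp only [Set.ofPred_and, Set.ofPred_forall]
  refine .inter ?_ (.inter ?_ (.inter ?_ (.inter ?_ ?_)))
  · exact isClosed_iInter fun i => isClosed_le (by fun_prop) (by fun_prop)
  · exact isClosed_iInter fun i => isClosed_le (by fun_prop) (by fun_prop)
  · exact isClosed_iInter fun i => isClosed_iInter fun j => isClosed_iInter fun _ =>
      isClosed_le (by fun_prop) (by fun_prop)
  · exact isClosed_iInter fun i => isClosed_le (by fun_prop) (by fun_prop)
  · exact isClosed_iInter fun i => isClosed_iInter fun j => isClosed_le (by fun_prop) (by fun_prop)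

theorem isClosed_setOf_inBidualCone (q : R3) :
    IsClosed {p : Fin 4 → R3 | InBidualCone p q} := by
  simp only [InBidualCone, Set.ofPred_forall]
  refine isClosed_iInter fun v => isClosed_imp ?_ isClosed_const
  simp only [Set.ofPred_forall]
  exact isOpen_iInter_of_finite fun i => isOpen_lt (by fun_prop) (by fun_prop)

theorem isCompact_setOf_admissible (hb : Bounds l k h q) :
    IsCompact {p | Admissible l k h q p} := by
  refine Metric.isCompact_of_isClosed_isBounded ?_ ?_
  · simp only [admissible_iff hb, Set.ofPred_and, Set.ofPred_forall]
    refine isClosed_setOf_metricConfig.inter (isClosed_iInter fun j =>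
      (isClosed_setOf_inBidualCone (q j)).inter (isClosed_iInter fun i => .inter ?_ ?_))
    · exact isClosed_le continuous_const (continuous_triple_apply _ _ _)
    · exact isClosed_le continuous_const (by unfold height; fun_prop)
  · refine (Metric.isBounded_closedBall (x := 0) (r := √8)).subset fun p hp => ?_
    rw [mem_closedBall_zero_iff, pi_norm_le_iff_of_nonneg (Real.sqrt_nonneg _)]
    exact fun i => (hp.norm_le i).trans (hb.l_lt i).le

theorem MetricConfig.update_reflection (hc : MetricConfig l k h q p) {n : R3}
    (hprev : inner ℝ n (p (i + 3)) = 0) (hnext : inner ℝ n (p (i + 1)) = 0)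
    (hopp : 0 ≤ inner ℝ n (p (i + 2))) (hi : 0 ≤ inner ℝ n (p i))
    (hq : ∀ j, 0 ≤ inner ℝ n (q j)) :
    MetricConfig l k h q (Function.update p i ((ℝ ∙ n)ᗮ.reflection (p i))) := by
  have dist_prev_le := hc.dist_le (i + 3)
  simp only [add_assoc, Fin.reduceAdd, add_zero] at dist_prev_le
  refine hc.update ?_ ?_ (forall_fin_four i (fun hi => absurd rfl hi) (fun _ => ?_) (fun _ => ?_)
    (fun _ => ?_)) ?_ ?_ fun j => (hc.le_dist i j).trans (dist_le_dist_reflection hi (hq j))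
  · rw [LinearIsometryEquiv.norm_map]; exact hc.two_le_norm i
  · rw [LinearIsometryEquiv.norm_map]; exact hc.norm_le i
  · rw [dist_reflection_of_inner_eq_zero _ hnext]; exact hc.two_le_dist _ _ (by simp)
  · exact (hc.two_le_dist i (i + 2) (by simp)).trans (dist_le_dist_reflection hi hopp)
  · rw [dist_reflection_of_inner_eq_zero _ hprev]; exact hc.two_le_dist _ _ (by simp)
  · rw [dist_reflection_of_inner_eq_zero _ hnext]; exact hc.dist_le i
  · rw [dist_reflection_of_inner_eq_zero _ hprev, dist_comm]; exact dist_prev_le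

theorem Admissible.exists_triple_nonneg [Nonempty ι] (ha : Admissible l k h q p)
    (hb : Bounds l k h q) (i : Fin 4) : ∃ p', Admissible l k h q p' ∧ (∀ j, ‖p' j‖ = ‖p j‖) ∧
      (∀ j, dist (p' j) (p' (j + 1)) = dist (p j) (p (j + 1))) ∧
      0 ≤ triple (p' (i + 3)) (p' i) (p' (i + 1)) := by
  rcases le_or_gt 0 (triple (p (i + 3)) (p i) (p (i + 1))) with ht | ht
  · exact ⟨p, ha, fun _ => rfl, fun _ => rfl, ht⟩
  have hp := ha.isFrame hb
  have htq (j : ι) : 0 < triple (q j) (p (i + 3)) (p (i + 1)) :=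
    (ha.encircles j).triple_pos_opposite hp ht
  set n := cross (p (i + 3)) (p (i + 1)) with hn
  have inner_n (x : R3) : inner ℝ n x = -triple (p (i + 3)) x (p (i + 1)) := by
    rw [hn, inner_cross_left, triple_rotate, triple_swap]
  have hprev : inner ℝ n (p (i + 3)) = 0 := by rw [hn, inner_cross_left, triple_self_left]
  have hnext : inner ℝ n (p (i + 1)) = 0 := by rw [hn, inner_cross_left, triple_self_outer]
  have hopp : 0 ≤ inner ℝ n (p (i + 2)) := by
    obtain ⟨j⟩ := ‹Nonempty ι›
    rw [hn, inner_cross_left, triple_rotate]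
    exact ((ha.encircles j).triple_pos_of_triple_opposite_pos hp (htq j)).le
  have hc := ha.update_reflection hprev hnext hopp (by linarith [inner_n (p i)])
    fun j => by rw [hn, inner_cross_left]; exact (htq j).le
  set p' := Function.update p i ((ℝ ∙ n)ᗮ.reflection (p i)) with hp'
  have update_ne (j : Fin 4) (hj : j ≠ i) : p' j = p j := Function.update_of_ne hj _ _
  have ht' : 0 ≤ triple (p' (i + 3)) (p' i) (p' (i + 1)) := by
    rw [update_ne (i + 3) (by simp), update_ne (i + 1) (by simp), hp', Function.update_self]
    linarith [inner_n (p i), inner_n ((ℝ ∙ n)ᗮ.reflection (p i)),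
      inner_reflection_orthogonal_singleton n (p i)]
  refine ⟨p', ⟨hc, fun j => (ha.encircles j).of_eq_of_ne hp (hc.isFrame hb) (hc.isAxis hb j)
    update_ne (htq j) ht'⟩, ?_, ?_, ht'⟩
  · exact (Function.forall_update_iff p fun j y => ‖y‖ = ‖p j‖).2
      ⟨LinearIsometryEquiv.norm_map _ _, fun _ _ => rfl⟩
  · refine forall_update_add_one (P := fun j y z => dist y z = dist (p j) (p (j + 1)))
      (fun _ => rfl) (dist_reflection_of_inner_eq_zero _ hnext) ?_
    simp only [add_assoc, Fin.reduceAdd, add_zero]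
    rw [dist_comm, dist_reflection_of_inner_eq_zero _ hprev, dist_comm]

end Admissible

section Rotation

/-- The component of `y` orthogonal to `d`. -/
noncomputable def rejection (d y : R3) : R3 :=
  (ℝ ∙ d)ᗮ.starProjection y

theorem rejection_eq (d y : R3) : rejection d y = y - (inner ℝ d y / ‖d‖ ^ 2) • d := by
  rw [rejection, Submodule.starProjection_orthogonal_val, Submodule.starProjection_singleton]
  rfl

theorem inner_rejection_left (d y : R3) : inner ℝ d (rejection d y) = 0 :=
  Submodule.mem_orthogonal_singleton_iff_inner_right.1 (Submodule.starProjection_apply_mem _ _)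

theorem inner_rejection_right (d y : R3) : inner ℝ (rejection d y) d = 0 := by
  rw [real_inner_comm, inner_rejection_left]

theorem inner_rejection_self (d y : R3) : inner ℝ (rejection d y) y = ‖rejection d y‖ ^ 2 :=
  (ℝ ∙ d)ᗮ.re_inner_starProjection_eq_normSq y

theorem inner_rejection_cross (d y : R3) : inner ℝ (rejection d y) (cross d y) = 0 := by
  rw [rejection_eq, inner_sub_left, real_inner_smul_left, inner_cross_right, inner_cross_right,
    triple_self_outer, triple_self_left, mul_zero, sub_zero]

theorem norm_cross_eq (d y : R3) : ‖cross d y‖ = ‖d‖ * ‖rejection d y‖ := by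
  rw [← sq_eq_sq₀ (norm_nonneg _) (by positivity), mul_pow, norm_cross_sq, ← inner_rejection_self,
    rejection_eq, inner_sub_left, real_inner_smul_left, real_inner_self_eq_norm_sq]
  rcases eq_or_ne d 0 with rfl | hd
  · simp
  · have := norm_ne_zero_iff.2 hd
    field

theorem rejection_ne_zero_of_triple_ne_zero {v d y : R3} (h : triple v d y ≠ 0) :
    rejection d y ≠ 0 := fun h0 => h <| by
  have hcross : cross d y = 0 := by rw [← norm_eq_zero, norm_cross_eq, h0, norm_zero, mul_zero]
  rw [← inner_cross_right, hcross, inner_zero_right]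

/-- The rotation of `x` about the line through `a` in direction `d`, parametrized by the tangent
of half the angle. -/
noncomputable def rotateAbout (a d x : R3) (s : ℝ) : R3 :=
  x + (2 * s / (1 + s ^ 2)) • (‖d‖⁻¹ • cross d (x - a) - s • rejection d (x - a))

variable {a d x v : R3}

theorem dist_rotateAbout_sq (hd : d ≠ 0) (a x v : R3) (s : ℝ) :
    dist (rotateAbout a d x s) v ^ 2 = dist x v ^ 2 + 4 * s / (1 + s ^ 2) *
      (‖d‖⁻¹ * triple (x - v) d (x - a) - s * inner ℝ (rejection d (x - a)) (a - v)) := by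
  have hs : 1 + s ^ 2 ≠ 0 := by positivity
  have norm_u : ‖‖d‖⁻¹ • cross d (x - a)‖ = ‖rejection d (x - a)‖ := by
    rw [norm_smul, norm_cross_eq, norm_inv, norm_norm,
      inv_mul_cancel_left₀ (norm_ne_zero_iff.2 hd)]
  have inner_u : inner ℝ (x - v) (‖d‖⁻¹ • cross d (x - a)) =
      ‖d‖⁻¹ * triple (x - v) d (x - a) := by
    rw [real_inner_smul_right, inner_cross_right]
  have inner_u_rejection : inner ℝ (‖d‖⁻¹ • cross d (x - a)) (rejection d (x - a)) = 0 := by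
    rw [real_inner_smul_left, real_inner_comm, inner_rejection_cross, mul_zero]
  have inner_rejection : inner ℝ (x - v) (rejection d (x - a)) =
      ‖rejection d (x - a)‖ ^ 2 + inner ℝ (rejection d (x - a)) (a - v) := by
    rw [← inner_rejection_self, ← inner_add_right, sub_add_sub_cancel, real_inner_comm]
  rw [dist_eq_norm, dist_eq_norm, rotateAbout, add_sub_right_comm, norm_add_sq_real, norm_smul,
    mul_pow, Real.norm_eq_abs, sq_abs, norm_sub_sq_real (‖d‖⁻¹ • _), norm_smul s, mul_pow,
    Real.norm_eq_abs, sq_abs, norm_u, real_inner_smul_right, inner_sub_right, inner_u,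
    real_inner_smul_right, real_inner_smul_right, inner_u_rejection, inner_rejection]
  field

theorem tendsto_rotateAbout (a d x : R3) : Filter.Tendsto (rotateAbout a d x) (𝓝[>] 0) (𝓝 x) := by
  have hcont : Continuous (rotateAbout a d x) := by
    have : ∀ s : ℝ, 1 + s ^ 2 ≠ 0 := fun s => by positivity
    unfold rotateAbout
    fun_prop (disch := assumption)
  simpa [rotateAbout] using (hcont.tendsto 0).mono_left (nhdsWithin_le_nhds (s := Set.Ioi 0))

theorem dist_rotateAbout_eq (hd : d ≠ 0) (htriple : triple (x - v) d (x - a) = 0)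
    (hinner : inner ℝ (rejection d (x - a)) (a - v) = 0) (s : ℝ) :
    dist (rotateAbout a d x s) v = dist x v := by
  rw [← sq_eq_sq₀ dist_nonneg dist_nonneg, dist_rotateAbout_sq hd, htriple, hinner, mul_zero,
    mul_zero, sub_zero, mul_zero, add_zero]

theorem dist_rotateAbout_left (hd : d ≠ 0) (a x : R3) (s : ℝ) :
    dist (rotateAbout a d x s) a = dist x a :=
  dist_rotateAbout_eq hd (triple_self_outer _ _) (by rw [sub_self, inner_zero_right]) s

theorem dist_rotateAbout_add (hd : d ≠ 0) (a x : R3) (s : ℝ) :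
    dist (rotateAbout a d x s) (a + d) = dist x (a + d) := by
  refine dist_rotateAbout_eq hd ?_ ?_ s
  · rw [← sub_sub, ← inner_cross_right, inner_sub_left, inner_cross_right, inner_cross_right,
      triple_self_outer, triple_self_left, sub_zero]
  · rw [sub_add_cancel_left, inner_neg_right, inner_rejection_right, neg_zero]

theorem eventually_mul_pos {A B : ℝ} (h : 0 < A ∨ A = 0 ∧ B < 0) :
    ∀ᶠ s : ℝ in 𝓝[>] 0, 0 < 4 * s / (1 + s ^ 2) * (A - s * B) := by
  have hpos : ∀ᶠ s : ℝ in 𝓝[>] 0, 0 < s := eventually_mem_nhdsWithin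
  have hsub : ∀ᶠ s : ℝ in 𝓝[>] 0, 0 < A - s * B := by
    rcases h with h | ⟨rfl, h⟩
    · have hcont : Continuous fun s : ℝ => A - s * B := by fun_prop
      exact ((hcont.tendsto 0).mono_left nhdsWithin_le_nhds).eventually_const_lt (by simpa using h)
    · filter_upwards [hpos] with s hs
      linarith [mul_neg_of_pos_of_neg hs h]
  filter_upwards [hpos, hsub] with s hs hsub
  positivity

theorem eventually_dist_lt_rotateAbout (hd : d ≠ 0) (h : 0 < triple (x - v) d (x - a) ∨
    triple (x - v) d (x - a) = 0 ∧ inner ℝ (rejection d (x - a)) (a - v) < 0) :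
    ∀ᶠ s in 𝓝[>] 0, dist x v < dist (rotateAbout a d x s) v := by
  have hn : 0 < ‖d‖⁻¹ := inv_pos.2 (norm_pos_iff.2 hd)
  filter_upwards [eventually_mul_pos (h.imp (mul_pos hn) (And.imp_left fun h0 => by
    rw [h0, mul_zero]))] with s hs
  rw [← sq_lt_sq₀ dist_nonneg dist_nonneg, dist_rotateAbout_sq hd]
  linarith

theorem eventually_rotateAbout_dist_lt (hd : d ≠ 0) (h : triple (x - v) d (x - a) < 0 ∨
    triple (x - v) d (x - a) = 0 ∧ 0 < inner ℝ (rejection d (x - a)) (a - v)) :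
    ∀ᶠ s in 𝓝[>] 0, dist (rotateAbout a d x s) v < dist x v := by
  have hn : 0 < ‖d‖⁻¹ := inv_pos.2 (norm_pos_iff.2 hd)
  have h' : 0 < -(‖d‖⁻¹ * triple (x - v) d (x - a)) ∨ -(‖d‖⁻¹ * triple (x - v) d (x - a)) = 0 ∧
      -inner ℝ (rejection d (x - a)) (a - v) < 0 :=
    h.imp (fun h => neg_pos.2 (mul_neg_of_pos_of_neg hn h))
      fun h => ⟨by rw [h.1, mul_zero, neg_zero], neg_neg_of_pos h.2⟩
  filter_upwards [eventually_mul_pos h'] with s hs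
  rw [← sq_lt_sq₀ dist_nonneg dist_nonneg, dist_rotateAbout_sq hd]
  linarith

end Rotation

section Deformation

variable {ι : Type*} {l k h : Fin 4 → ℝ} {q : ι → R3} {p : Fin 4 → R3} {i : Fin 4}

theorem triple_sub_sub_sub (v a b x : R3) : triple (x - v) (b - a) (x - a) =
    triple v a x + triple v x b + triple v b a - triple a x b := by
  simp only [triple_eq_coords, PiLp.sub_apply]
  ring

theorem triple_sub_neg (v a x : R3) : triple (x - v) (-a) x = triple v a x := by
  simp only [triple_eq_coords, PiLp.sub_apply, PiLp.neg_apply]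
  ring

theorem inner_rejection_pos_of_eq_add {a b x : R3} {α β : ℝ} (hsum : 1 < α + β)
    (hx : x = α • a + β • b) (hne : rejection (b - a) (x - a) ≠ 0) :
    0 < inner ℝ (rejection (b - a) (x - a)) a := by
  set e := rejection (b - a) (x - a)
  have hb : inner ℝ e b = inner ℝ e a := by
    rw [← sub_eq_zero, ← inner_sub_right, inner_rejection_right]
  have hex : inner ℝ e x = (α + β) * inner ℝ e a := by
    rw [hx, inner_add_right, real_inner_smul_right, real_inner_smul_right, hb, add_mul]
  have hself : inner ℝ e x - inner ℝ e a = ‖e‖ ^ 2 := by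
    rw [← inner_sub_right, inner_rejection_self]
  have hpos : 0 < ‖e‖ ^ 2 := by positivity
  exact pos_of_mul_pos_right (a := α + β - 1) (by linarith) (by linarith)

theorem inner_rejection_neg_pos_of_eq_add {a b x : R3} {α β : ℝ} (hβ : 0 < β)
    (hx : x = α • a + β • b) (hne : rejection (-a) x ≠ 0) :
    0 < inner ℝ (rejection (-a) x) b := by
  set e := rejection (-a) x
  have ha : inner ℝ e a = 0 := by
    rw [← neg_eq_zero, ← inner_neg_right, inner_rejection_right]
  have hex : inner ℝ e x = β * inner ℝ e b := by
    nth_rewrite 1 [hx]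
    rw [inner_add_right, real_inner_smul_right, real_inner_smul_right, ha, mul_zero, zero_add]
  have hpos : 0 < ‖e‖ ^ 2 := by positivity
  exact pos_of_mul_pos_right (hex ▸ inner_rejection_self (-a) x ▸ hpos) hβ.le

/-- The rotation about the line through the neighbours moves the vertex towards the origin; when
the vertex is in the plane through `0` and its neighbours this is a second-order effect, which
depends on `0` and `p i` being on different sides of that line. -/
theorem Encircles.eventually_norm_rotateAbout_lt {q : R3} (he : Encircles p q) (hp : IsFrame p)
    (hne : p (i + 1) - p (i + 3) ≠ 0) (ht : 0 ≤ triple (p (i + 3)) (p i) (p (i + 1))) :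
    ∀ᶠ s in 𝓝[>] 0, ‖rotateAbout (p (i + 3)) (p (i + 1) - p (i + 3)) (p i) s‖ < ‖p i‖ := by
  suffices h : ∀ᶠ s in 𝓝[>] 0, dist (rotateAbout (p (i + 3)) (p (i + 1) - p (i + 3)) (p i) s) 0 <
      dist (p i) 0 by simpa only [dist_zero_right] using h
  refine eventually_rotateAbout_dist_lt hne ?_
  have htriple : triple (p i - 0) (p (i + 1) - p (i + 3)) (p i - p (i + 3)) =
      -triple (p (i + 3)) (p i) (p (i + 1)) := by
    rw [triple_sub_sub_sub]
    simp [triple]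
  rw [htriple, sub_zero, neg_neg_iff_pos, neg_eq_zero]
  refine ht.lt_or_eq.imp id fun h0 => ⟨h0.symm, ?_⟩
  obtain ⟨hpos, hx⟩ := he.eq_add_smul_of_triple_eq_zero hp h0.symm
  have hlt := he.triple_lt_of_triple_eq_zero hp h0.symm
  have hne : rejection (p (i + 1) - p (i + 3)) (p i - p (i + 3)) ≠ 0 := by
    refine rejection_ne_zero_of_triple_ne_zero (v := p i - q) (ne_of_gt ?_)
    rw [triple_sub_sub_sub, ← h0, triple_swap q (p (i + 3)) (p (i + 1))]
    linarith
  refine inner_rejection_pos_of_eq_add ?_ hx hne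
  rw [← add_div, one_lt_div hpos]
  linarith

theorem Admissible.exists_norm_lt [Finite ι] [Nonempty ι] (ha : Admissible l k h q p)
    (hb : Bounds l k h q) (hmax : ∀ j, ‖p j‖ ≤ ‖p i‖) (hi : 2 < ‖p i‖)
    (ht : 0 ≤ triple (p (i + 3)) (p i) (p (i + 1))) :
    ∃ x, Admissible l k h q (Function.update p i x) ∧ ‖x‖ < ‖p i‖ := by
  have hp := ha.isFrame hb
  set d := p (i + 1) - p (i + 3) with hd
  have hd0 : d ≠ 0 := by
    rw [← norm_pos_iff, hd, ← dist_eq_norm]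
    exact two_pos.trans_le (ha.two_le_dist _ _ (by simp))
  have dist_prev (s : ℝ) := dist_rotateAbout_left hd0 (p (i + 3)) (p i) s
  have dist_next (s : ℝ) := dist_rotateAbout_add hd0 (p (i + 3)) (p i) s
  rw [add_sub_cancel] at dist_next
  have dist_prev_le := ha.dist_le (i + 3)
  simp only [add_assoc, Fin.reduceAdd, add_zero] at dist_prev_le
  have hlim := tendsto_rotateAbout (p (i + 3)) d (p i)
  have hlt : ∀ᶠ s in 𝓝[>] 0, ‖rotateAbout (p (i + 3)) d (p i) s‖ < ‖p i‖ := by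
    obtain ⟨j⟩ := ‹Nonempty ι›
    exact (ha.encircles j).eventually_norm_rotateAbout_lt hp hd0 ht
  have le_dist (j : ι) : ∀ᶠ s in 𝓝[>] 0, h i ≤ dist (rotateAbout (p (i + 3)) d (p i) s) (q j) := by
    rcases (ha.le_dist i j).lt_or_eq with hj | hj
    · exact ((hlim.dist tendsto_const_nhds).eventually_const_lt hj).mono fun _ h => h.le
    · have := (ha.encircles j).triple_add_triple_lt hp (ha.isAxis hb j) hmax (hj ▸ hb.h_le i) ht
      refine hj ▸ (eventually_dist_lt_rotateAbout hd0 (.inl ?_)).mono fun _ h => h.le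
      rw [hd, triple_sub_sub_sub, triple_swap (q j) (p (i + 3)) (p (i + 1))]
      linarith
  have := ha.eventually_update hb hlim
    ((hlim.norm.eventually_const_lt hi).mono fun _ h => h.le)
    (hlt.mono fun _ hs => hs.le.trans (ha.norm_le i))
    (.of_forall fun s => by rw [dist_next]; exact ha.two_le_dist _ _ (by simp))
    (.of_forall fun s => by rw [dist_next]; exact ha.dist_le i)
    (.of_forall fun s => by rw [dist_prev]; exact ha.two_le_dist _ _ (by simp))
    (.of_forall fun s => by rw [dist_prev, dist_comm]; exact dist_prev_le) le_dist
  obtain ⟨s, hs⟩ := (this.and hlt).exists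
  exact ⟨_, hs⟩

theorem Encircles.eventually_dist_lt_rotateAbout {q : R3} (he : Encircles p q) (hp : IsFrame p)
    (hne : -p (i + 3) ≠ 0) (ht : 0 ≤ triple (p (i + 3)) (p i) (p (i + 1))) : ∀ᶠ s in 𝓝[>] 0,
      dist (p i) (p (i + 1)) < dist (rotateAbout 0 (-p (i + 3)) (p i) s) (p (i + 1)) := by
  refine _root_.eventually_dist_lt_rotateAbout hne ?_
  rw [sub_zero, triple_sub_neg, triple_rotate, zero_sub, inner_neg_right, neg_neg_iff_pos]
  refine ht.lt_or_eq.imp id fun h0 => ⟨h0.symm, ?_⟩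
  obtain ⟨hpos, hx⟩ := he.eq_add_smul_of_triple_eq_zero hp h0.symm
  have hprev := he.triple_pos (i + 3)
  simp only [add_assoc, Fin.reduceAdd, add_zero] at hprev
  refine inner_rejection_neg_pos_of_eq_add (div_pos hprev hpos) hx
    (rejection_ne_zero_of_triple_ne_zero (v := p i - q) ?_)
  rw [triple_sub_neg]
  exact hprev.ne'

theorem Admissible.exists_lt_dist [Finite ι] [Nonempty ι] (ha : Admissible l k h q p)
    (hb : Bounds l k h q) (hi : dist (p i) (p (i + 1)) < k i)
    (ht : 0 ≤ triple (p (i + 3)) (p i) (p (i + 1))) :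
    ∃ x, Admissible l k h q (Function.update p i x) ∧ ‖x‖ = ‖p i‖ ∧
      dist x (p (i + 3)) = dist (p i) (p (i + 3)) ∧
      dist (p i) (p (i + 1)) < dist x (p (i + 1)) := by
  have hp := ha.isFrame hb
  have hd : -p (i + 3) ≠ 0 :=
    neg_ne_zero.2 (norm_pos_iff.1 (two_pos.trans_le (ha.two_le_norm _)))
  have norm_eq (s : ℝ) : ‖rotateAbout 0 (-p (i + 3)) (p i) s‖ = ‖p i‖ := by
    simpa only [dist_zero_right] using dist_rotateAbout_left hd 0 (p i) s
  have dist_prev (s : ℝ) :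
      dist (rotateAbout 0 (-p (i + 3)) (p i) s) (p (i + 3)) = dist (p i) (p (i + 3)) := by
    refine dist_rotateAbout_eq hd ?_ ?_ s
    · rw [sub_zero, triple_sub_neg, triple_self_left]
    · rw [zero_sub, inner_rejection_right]
  have dist_prev_le := ha.dist_le (i + 3)
  simp only [add_assoc, Fin.reduceAdd, add_zero] at dist_prev_le
  have hlim := tendsto_rotateAbout 0 (-p (i + 3)) (p i)
  have hlt : ∀ᶠ s in 𝓝[>] 0,
      dist (p i) (p (i + 1)) < dist (rotateAbout 0 (-p (i + 3)) (p i) s) (p (i + 1)) := by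
    obtain ⟨j⟩ := ‹Nonempty ι›
    exact (ha.encircles j).eventually_dist_lt_rotateAbout hp hd ht
  have le_dist (j : ι) :
      ∀ᶠ s in 𝓝[>] 0, h i ≤ dist (rotateAbout 0 (-p (i + 3)) (p i) s) (q j) := by
    have hprev := (ha.encircles j).triple_pos (i + 3)
    simp only [add_assoc, Fin.reduceAdd, add_zero] at hprev
    refine (_root_.eventually_dist_lt_rotateAbout hd (.inl ?_)).mono
      fun _ h => (ha.le_dist i j).trans h.le
    rwa [sub_zero, triple_sub_neg]
  have := ha.eventually_update hb hlim
    (.of_forall fun s => by rw [norm_eq]; exact ha.two_le_norm i)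
    (.of_forall fun s => by rw [norm_eq]; exact ha.norm_le i)
    (hlt.mono fun s hs => (ha.two_le_dist _ _ (by simp)).trans hs.le)
    (((hlim.dist tendsto_const_nhds).eventually_lt_const hi).mono fun _ h => h.le)
    (.of_forall fun s => by rw [dist_prev]; exact ha.two_le_dist _ _ (by simp))
    (.of_forall fun s => by rw [dist_prev, dist_comm]; exact dist_prev_le) le_dist
  obtain ⟨s, hs, hs_lt⟩ := (this.and hlt).exists
  exact ⟨_, hs, norm_eq s, dist_prev s, hs_lt⟩

end Deformation

section Extremal

variable {ι : Type*} {l k h : Fin 4 → ℝ} {q : ι → R3} {p : Fin 4 → R3} {L : ℝ}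

theorem Admissible.exists_norm_eq_two [Finite ι] [Nonempty ι] (ha : Admissible l k h q p)
    (hb : Bounds l k h q) : ∃ p', Admissible l k h q p' ∧ ∀ i, ‖p' i‖ = 2 := by
  obtain ⟨p₀, ha₀, hmin⟩ := (isCompact_setOf_admissible hb).exists_isMinOn ⟨p, ha⟩
    (show ContinuousOn (fun p : Fin 4 → R3 => ∑ i, ‖p i‖) _ by fun_prop)
  refine ⟨p₀, ha₀, ?_⟩
  obtain ⟨i, hi⟩ := Finite.exists_max fun i => ‖p₀ i‖
  suffices ‖p₀ i‖ ≤ 2 from fun j => ((hi j).trans this).antisymm (ha₀.two_le_norm j)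
  by_contra! hlt
  obtain ⟨p₁, ha₁, norm_eq, -, ht⟩ := ha₀.exists_triple_nonneg hb i
  obtain ⟨x, hx, hx_lt⟩ := ha₁.exists_norm_lt hb (by simpa only [norm_eq] using hi)
    (by rwa [norm_eq]) ht
  have hle (j : Fin 4) : ‖Function.update p₁ i x j‖ ≤ ‖p₀ j‖ :=
    (Function.forall_update_iff p₁ fun j y => ‖y‖ ≤ ‖p₀ j‖).2
      ⟨norm_eq i ▸ hx_lt.le, fun j _ => (norm_eq j).le⟩ j
  refine (hmin hx).not_gt (Finset.sum_lt_sum (fun j _ => hle j) ⟨i, Finset.mem_univ i, ?_⟩)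
  rwa [Function.update_self, ← norm_eq]

theorem Admissible.exists_extremal [Finite ι] [Nonempty ι] (ha : Admissible l k h q p)
    (hb : Bounds l k h q) : ∃ p', Admissible l k h q p' ∧ (∀ i, ‖p' i‖ = 2) ∧
      ∀ i, dist (p' i) (p' (i + 1)) = k i := by
  obtain ⟨p', ha', norm_eq'⟩ := ha.exists_norm_eq_two hb
  have hclosed : IsClosed {p : Fin 4 → R3 | ∀ i, ‖p i‖ = 2} := by
    simp only [Set.ofPred_forall]
    exact isClosed_iInter fun i => isClosed_eq (by fun_prop) continuous_const
  obtain ⟨p₀, ⟨ha₀, norm_eq₀⟩, hmax⟩ :=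
    ((isCompact_setOf_admissible hb).inter_right hclosed).exists_isMaxOn ⟨p', ha', norm_eq'⟩
      (show ContinuousOn (fun p : Fin 4 → R3 => ∑ i, dist (p i) (p (i + 1))) _ by fun_prop)
  refine ⟨p₀, ha₀, norm_eq₀, fun i => (ha₀.dist_le i).eq_of_not_lt fun hlt => ?_⟩
  obtain ⟨p₁, ha₁, norm_eq, dist_eq, ht⟩ := ha₀.exists_triple_nonneg hb i
  obtain ⟨x, hx, hx_norm, hx_prev, hx_next⟩ := ha₁.exists_lt_dist hb (by rwa [dist_eq]) ht
  have hx_mem : ∀ j, ‖Function.update p₁ i x j‖ = 2 :=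
    (Function.forall_update_iff p₁ fun _ y => ‖y‖ = 2).2
      ⟨by rw [hx_norm, norm_eq, norm_eq₀], fun j _ => by rw [norm_eq, norm_eq₀]⟩
  have hle (j : Fin 4) : dist (p₀ j) (p₀ (j + 1)) ≤
      dist (Function.update p₁ i x j) (Function.update p₁ i x (j + 1)) := by
    refine forall_update_add_one (P := fun j y z => dist (p₀ j) (p₀ (j + 1)) ≤ dist y z)
      (fun j => (dist_eq j).ge) (dist_eq i ▸ hx_next.le) ?_ j
    rw [← dist_eq, dist_comm _ x, hx_prev, dist_comm (p₁ i)]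
    simp only [add_assoc, Fin.reduceAdd, add_zero, le_refl]
  refine (hmax ⟨hx, hx_mem⟩).not_gt
    (Finset.sum_lt_sum (fun j _ => hle j) ⟨i, Finset.mem_univ i, ?_⟩)
  rwa [Function.update_self, Function.update_of_ne (by simp), ← dist_eq]

theorem Encircles.smul {q : R3} (he : Encircles p q) {t : ℝ} (ht : 0 < t) :
    Encircles p (t • q) where
  triple_pos i := by
    rw [triple_smul_left]
    exact mul_pos ht (he.triple_pos i)
  inBidualCone v hv := by
    rw [real_inner_smul_right]
    exact mul_nonneg ht.le (he.inBidualCone v hv)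

theorem Admissible.smul (ha : Admissible l k h q p) (hb : Bounds l k h q) {t : ι → ℝ}
    (ht : ∀ j, 1 ≤ t j) : Admissible l k h (fun j => t j • q j) p where
  __ := ha
  le_dist i j := (ha.le_dist i j).trans <| dist_le_dist_smul (ht j) <|
    inner_le_norm_sq ((ha.norm_le i).trans (hb.l_lt i).le) (hb.two_le_norm j)
      ((hb.two_le_h i).trans (ha.le_dist i j))
  encircles j := (ha.encircles j).smul (zero_lt_one.trans_le (ht j))

theorem dist_le_dist_smul_smul {a b : R3} {s t : ℝ} (ha : 2 ≤ ‖a‖) (hb : 2 ≤ ‖b‖)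
    (hs : 1 ≤ s) (ht : 1 ≤ t) (ha8 : ‖a‖ ≤ √8) (htb8 : ‖t • b‖ ≤ √8) (hab : 2 ≤ dist a b) :
    dist a b ≤ dist (s • a) (t • b) := by
  have h : dist a b ≤ dist a (t • b) := dist_le_dist_smul ht (inner_le_norm_sq ha8 hb hab)
  refine h.trans ?_
  rw [dist_comm a, dist_comm (s • a)]
  exact dist_le_dist_smul hs (inner_le_norm_sq htb8 ha (dist_comm a _ ▸ hab.trans h))

theorem MetricConfig.neg (hc : MetricConfig l k h q p) : MetricConfig l k h (-q) (-p) where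
  two_le_norm i := by simpa using hc.two_le_norm i
  norm_le i := by simpa using hc.norm_le i
  two_le_dist i j hij := by simpa using hc.two_le_dist i j hij
  dist_le i := by simpa using hc.dist_le i
  le_dist i j := by simpa using hc.le_dist i j

/-- The configurations of the theorem, with an arbitrary family of points `q j` in place of one or
two of them; `ε` bounds their mutual distances from below. -/
structure IsLinkedConfig (l k h : Fin 4 → ℝ) (ε : ι → ι → ℝ) (L : ℝ) (p : Fin 4 → R3)
    (q : ι → R3) : Prop extends MetricConfig l k h q p where
  two_le_norm_q : ∀ j, 2 ≤ ‖q j‖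
  norm_q_le : ∀ j, ‖q j‖ ≤ L
  le_dist_q : ∀ j m, j ≠ m → ε j m ≤ dist (q j) (q m)
  links : ∀ j, HalfLineLinks (q j) p

theorem isSevenPointConfig_iff {ε : ℝ} {q : Fin 2 → R3} :
    IsSevenPointConfig l k h ε L p q ↔ IsLinkedConfig l k h (fun _ _ => ε) L p q where
  mp hc := ⟨⟨hc.two_le_norm_p, hc.norm_p_le, hc.two_le_dist_p, hc.dist_p_le, hc.le_dist_p_q⟩,
    hc.two_le_norm_q, hc.norm_q_le, by
      simpa [Fin.forall_fin_two, dist_comm (q 1)] using hc.le_dist_q, hc.links⟩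
  mpr hc := ⟨hc.two_le_norm, hc.two_le_norm_q, hc.two_le_dist, hc.le_dist,
    hc.le_dist_q 0 1 (by simp), hc.norm_le, hc.norm_q_le, hc.dist_le, hc.links⟩

theorem isSixPointConfig_iff {ε : Unit → Unit → ℝ} {q : Unit → R3} :
    IsSixPointConfig l k h L p (q ()) ↔ IsLinkedConfig l k h ε L p q where
  mp hc := ⟨⟨hc.two_le_norm_p, hc.norm_p_le, hc.two_le_dist_p, hc.dist_p_le,
    fun i _ => hc.le_dist_p_q i⟩, fun _ => hc.two_le_norm_q, fun _ => hc.norm_q_le,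
    fun _ _ hjm => absurd rfl hjm, fun _ => hc.links⟩
  mpr hc := ⟨hc.two_le_norm, hc.two_le_norm_q (), hc.two_le_dist, fun i => hc.le_dist i (),
    hc.norm_le, hc.norm_q_le (), hc.dist_le, hc.links ()⟩

theorem IsLinkedConfig.bounds {ε : ι → ι → ℝ} (hc : IsLinkedConfig l k h ε L p q)
    (hl : ∀ i, l i < √8) (hk : ∀ i, k i ≤ 2.61) (hh : ∀ i, h i ∈ Set.Icc 2 √8) (hL : L ≤ √8) :
    Bounds l k h q :=
  ⟨hl, hk, fun i => (hh i).1, fun i => (hh i).2, hc.two_le_norm_q,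
    fun j => (hc.norm_q_le j).trans hL⟩

theorem IsLinkedConfig.exists_admissible {ε : ι → ι → ℝ} (hc : IsLinkedConfig l k h ε L p q)
    (hb : Bounds l k h q) : ∃ p' q', Admissible l k h q' p' ∧ Bounds l k h q' ∧
      (∀ j, ‖q' j‖ = ‖q j‖) ∧ ∀ j m, dist (q' j) (q' m) = dist (q j) (q m) := by
  have hp := hc.isFrame hb
  have hor (j : ι) := (hc.links j).encircles hp (hc.isAxis hb j)
  by_cases hall : ∀ j, Encircles p (q j)
  · exact ⟨p, q, ⟨hc.toMetricConfig, hall⟩, hb, fun _ => rfl, fun _ _ => rfl⟩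
  obtain ⟨j₀, hj₀⟩ := not_forall.1 hall
  have h₀ := (hor j₀).resolve_left hj₀
  refine ⟨-p, -q, ⟨hc.neg, fun j => (hor j).resolve_left fun he => he.not_encircles_neg hp h₀⟩,
    ⟨hb.l_lt, hb.k_le, hb.two_le_h, hb.h_le, ?_, ?_⟩, ?_, ?_⟩ <;>
    simp [hb.two_le_norm, hb.norm_le]

theorem mainTheorem1_general [Finite ι] [Nonempty ι] {ε : ι → ι → ℝ} (hl : ∀ i, l i < √8)
    (hk : ∀ i, k i ≤ 2.61) (hh : ∀ i, h i ∈ Set.Icc 2 √8) (hL : L ≤ √8)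
    (hε : ∀ j m, j ≠ m → 2 ≤ ε j m) (hc : IsLinkedConfig l k h ε L p q) :
    ∃ p' q', IsLinkedConfig l k h ε L p' q' ∧ (∀ i, ‖p' i‖ = 2) ∧
      (∀ i, dist (p' i) (p' (i + 1)) = k i) ∧ ∀ j, ‖q' j‖ = L := by
  obtain ⟨p₁, q₁, ha₁, hb₁, norm_eq, dist_eq⟩ := hc.exists_admissible (hc.bounds hl hk hh hL)
  have norm_le (j : ι) : ‖q₁ j‖ ≤ L := (norm_eq j).trans_le (hc.norm_q_le j)
  have norm_pos (j : ι) : 0 < ‖q₁ j‖ := two_pos.trans_le (hb₁.two_le_norm j)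
  have one_le (j : ι) : 1 ≤ L / ‖q₁ j‖ := (one_le_div (norm_pos j)).2 (norm_le j)
  have norm_smul_eq (j : ι) : ‖(L / ‖q₁ j‖) • q₁ j‖ = L := by
    rw [norm_smul, Real.norm_of_nonneg (zero_le_one.trans (one_le j)),
      div_mul_cancel₀ _ (norm_pos j).ne']
  have two_le (j : ι) : 2 ≤ ‖(L / ‖q₁ j‖) • q₁ j‖ :=
    (norm_smul_eq j).symm ▸ (hb₁.two_le_norm j).trans (norm_le j)
  have le_sqrt (j : ι) : ‖(L / ‖q₁ j‖) • q₁ j‖ ≤ √8 := (norm_smul_eq j).trans_le hL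
  have hb₂ : Bounds l k h fun j => (L / ‖q₁ j‖) • q₁ j := { hb₁ with
    two_le_norm := two_le
    norm_le := le_sqrt }
  obtain ⟨p', ha', hnorm, hdist⟩ := (ha₁.smul hb₁ one_le).exists_extremal hb₂
  refine ⟨p', _, ⟨ha'.toMetricConfig, two_le, fun j => (norm_smul_eq j).le, fun j m hjm => ?_,
    fun j => (ha'.encircles j).halfLineLinks (ha'.isFrame hb₂) (ha'.isAxis hb₂ j)⟩, hnorm, hdist,
    norm_smul_eq⟩
  have le_dist := dist_eq j m ▸ hc.le_dist_q j m hjm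
  exact le_dist.trans (dist_le_dist_smul_smul (hb₁.two_le_norm j) (hb₁.two_le_norm m) (one_le j)
    (one_le m) (hb₁.norm_le j) (le_sqrt m) ((hε j m hjm).trans le_dist))

end Extremal

theorem mainTheorem1 (l k h : Fin 4 → ℝ) (L : ℝ)
    (hl : ∀ i, l i < Real.sqrt 8)
    (hk : ∀ i, k i ∈ Set.Icc (2 : ℝ) 2.61)
    (hh : ∀ i, h i ∈ Set.Icc (2 : ℝ) (Real.sqrt 8))
    (hL : L ∈ Set.Icc (2 : ℝ) (Real.sqrt 8)) :
    (∀ ε : ℝ, 2 ≤ ε →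
      (∃ (p : Fin 4 → R3) (q : Fin 2 → R3), IsSevenPointConfig l k h ε L p q) →
      ∃ (p : Fin 4 → R3) (q : Fin 2 → R3), IsSevenPointConfig l k h ε L p q ∧
        (∀ i, ‖p i‖ = 2) ∧ (∀ i, dist (p i) (p (i + 1)) = k i) ∧ (∀ j, ‖q j‖ = L)) ∧
    ((∃ (p : Fin 4 → R3) (q : R3), IsSixPointConfig l k h L p q) →
      ∃ (p : Fin 4 → R3) (q : R3), IsSixPointConfig l k h L p q ∧
        (∀ i, ‖p i‖ = 2) ∧ (∀ i, dist (p i) (p (i + 1)) = k i) ∧ ‖q‖ = L) := by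
  have hk' (i : Fin 4) : k i ≤ 2.61 := (hk i).2
  simp only [isSevenPointConfig_iff]
  refine ⟨fun ε hε ⟨p, q, hc⟩ => mainTheorem1_general hl hk' hh hL.2 (fun _ _ _ => hε) hc, ?_⟩
  rintro ⟨p, q, hc⟩
  obtain ⟨p', q', hc', hnorm, hdist, hq⟩ := mainTheorem1_general (ε := fun _ _ => 2) hl hk' hh hL.2
    (fun _ _ _ => le_rfl) (isSixPointConfig_iff (q := fun _ => q).1 hc)
  exact ⟨p', q' (), isSixPointConfig_iff.2 hc', hnorm, hdist, hq ()⟩
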